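/- Let $M$ be a closed (compact, without boundary) oriented smooth Riemannian manifold of dimension $n+p$, with Levi-Civita connection $\nabla$ and volume element $d\nu$, and let $\mathcal F$ and $\mathcal F^{\bot}$ be $C^\infty$ foliations of $M$ with leaves of dimension $n$ and $p$ respectively, whose leaves are orthogonal to each other at every point of $M$. At a point of $M$ let $e_1,\dots,e_n,e_{n+1},\dots,e_{n+p}$ be a local orthonormal frame with $e_i$ tangent to $\mathcal F$ for $1\le i\le n$ and $e_\alpha$ tangent to $\mathcal F^{\bot}$ for $n+1\le\alpha\le n+p$, and let $X^{\top}$ and $X^{\bot}$ denote the orthogonal projections of a vector $X$ to $T\mathcal F$ and $T\mathcal F^{\bot}$. Put $$B_{\mathcal F}(e_i,e_j)=(\nabla_{e_i}e_j)^{\bot},\qquad B_{\mathcal F^{\bot}}(e_\alpha,e_\beta)=(\nabla_{e_\alpha}e_\beta)^{\top},$$ $$\|B_{\mathcal F}\|^2=\sum_{i,j}\|B_{\mathcal F}(e_i,e_j)\|^2,\qquad \|B_{\mathcal F^{\bot}}\|^2=\sum_{\alpha,\beta}\|B_{\mathcal F^{\bot}}(e_\alpha,e_\beta)\|^2,$$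 $$h=\sum_i(\nabla_{e_i}e_i)^{\bot},\qquad h^{\bot}=\sum_\alpha(\nabla_{e_\alpha}e_\alpha)^{\top},\qquad K(\mathcal F,\mathcal F^{\bot})=\sum_{i,\alpha}\langle R(e_\alpha,e_i)e_i,e_\alpha\rangle,$$ where $R(X,Y)Z=\nabla_X\nabla_YZ-\nabla_Y\nabla_XZ-\nabla_{[X,Y]}Z$; these functions and vector fields do not depend on the choice of the frame. Then the function $K(\mathcal F,\mathcal F^{\bot})+\|B_{\mathcal F}\|^2+\|B_{\mathcal F^{\bot}}\|^2-\|h\|^2-\|h^{\bot}\|^2$ is integrable on $M$ and $$\int_{M}\left(K(\mathcal F,\mathcal F^{\bot})+\|B_{\mathcal F}\|^2+\|B_{\mathcal F^{\bot}}\|^2-\|h\|^2-\|h^{\bot}\|^2\right)d\nu=0.$$ -/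

import Mathlib

open Bundle Manifold MeasureTheory Topology
open scoped ContDiff

noncomputable section

section LeviCivita

variable {E : Type*} [NormedAddCommGroup E] [NormedSpace ℝ E] {H : Type*} [TopologicalSpace H]
  {I : ModelWithCorners ℝ E H} {M : Type*} [TopologicalSpace M] [ChartedSpace H M]
  [RiemannianBundle (fun x : M => TangentSpace I x)]

/-- The pointwise inner product of two vector fields. -/
def innerField (X Y : ∀ x : M, TangentSpace I x) : M → ℝ :=
  fun x => inner ℝ (X x) (Y x)

/-- The right-hand side of the Koszul formula for `⟨∇_X Y, Z⟩` at `x`. -/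
def koszul (X Y Z : ∀ x : M, TangentSpace I x) (x : M) : ℝ :=
  (1 / 2 : ℝ) *
    (mvfderiv I (innerField Y Z) x (X x) + mvfderiv I (innerField X Z) x (Y x)
      - mvfderiv I (innerField X Y) x (Z x)
      + inner ℝ (VectorField.mlieBracket I X Y x) (Z x)
      - inner ℝ (VectorField.mlieBracket I X Z x) (Y x)
      - inner ℝ (VectorField.mlieBracket I Y Z x) (X x))

theorem innerField_smul_left (f : M → ℝ) (X Y : ∀ x : M, TangentSpace I x) :
    innerField (f • X) Y = f * innerField X Y := by
  ext x; simp [innerField, inner_smul_left]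

theorem innerField_add_left (X X' Y : ∀ x : M, TangentSpace I x) :
    innerField (X + X') Y = innerField X Y + innerField X' Y := by
  ext x; simp [innerField, inner_add_left]

theorem innerField_comm (X Y : ∀ x : M, TangentSpace I x) :
    innerField X Y = innerField Y X := by
  ext x; simp [innerField, real_inner_comm]

variable [IsManifold I ∞ M]

open FiberBundle in
theorem leviCivitaFun_ext {x : M} {A B : TangentSpace I x →L[ℝ] TangentSpace I x}
    (h : ∀ X Z : ∀ x : M, TangentSpace I x, MDiffAt (T% X) x → MDiffAt (T% Z) x →
      (inner ℝ (A (X x)) (Z x) : ℝ) = inner ℝ (B (X x)) (Z x)) : A = B := by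
  ext1 v
  refine ext_inner_right ℝ fun w => ?_
  have := h (extend E v) (extend E w)
    (mdifferentiableAt_extend ..) (mdifferentiableAt_extend ..)
  simpa using this

variable
  [IsContMDiffRiemannianBundle I ∞ E
    (fun x : M => TangentSpace I x)]

theorem mdiffAt_innerField {X Y : ∀ x : M, TangentSpace I x} {x : M}
    (hX : MDiffAt (T% X) x) (hY : MDiffAt (T% Y) x) : MDiffAt (innerField X Y) x :=
  MDifferentiableAt.inner_bundle (IB := I) (F := E) (E := fun x : M => TangentSpace I x)
    (b := fun x : M => x) hX hY

variable [FiniteDimensional ℝ E]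

instance instFiniteDimensionalTangentSpace (x : M) :
    FiniteDimensional ℝ (TangentSpace I x) :=
  VectorBundle.finiteDimensional ℝ E
    (fun x : M => TangentSpace I x) x

instance instCompleteSpaceTangentSpace (x : M) : CompleteSpace (TangentSpace I x) :=
  FiniteDimensional.complete ℝ _

theorem tensorialAt_koszul_left {Y Z : ∀ x : M, TangentSpace I x} {x : M}
    (hY : MDiffAt (T% Y) x) (hZ : MDiffAt (T% Z) x) :
    TensorialAt I E (fun X => koszul X Y Z x) x where
  smul {f X} hf hX := by
    have : CompleteSpace E := FiniteDimensional.complete ℝ E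
    simp only [koszul, innerField_smul_left]
    rw [mvfderiv_mul hf (mdiffAt_innerField hX hZ), mvfderiv_mul hf (mdiffAt_innerField hX hY),
      VectorField.mlieBracket_smul_left hf hX, VectorField.mlieBracket_smul_left hf hX]
    simp [inner_add_left, inner_smul_left, inner_smul_right, innerField]
    ring
  add {X X'} hX hX' := by
    have : CompleteSpace E := FiniteDimensional.complete ℝ E
    simp only [koszul, innerField_add_left]
    rw [mvfderiv_add (mdiffAt_innerField hX hZ) (mdiffAt_innerField hX' hZ),
      mvfderiv_add (mdiffAt_innerField hX hY) (mdiffAt_innerField hX' hY),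
      VectorField.mlieBracket_add_left hX hX', VectorField.mlieBracket_add_left hX hX']
    simp [inner_add_left, inner_add_right]
    ring

theorem tensorialAt_koszul_right {X Y : ∀ x : M, TangentSpace I x} {x : M}
    (hX : MDiffAt (T% X) x) (hY : MDiffAt (T% Y) x) :
    TensorialAt I E (fun Z => koszul X Y Z x) x where
  smul {f Z} hf hZ := by
    have : CompleteSpace E := FiniteDimensional.complete ℝ E
    simp only [koszul, innerField_comm _ (f • Z), innerField_smul_left]
    rw [mvfderiv_mul hf (mdiffAt_innerField hZ hY), mvfderiv_mul hf (mdiffAt_innerField hZ hX),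
      VectorField.mlieBracket_smul_right hf hZ, VectorField.mlieBracket_smul_right hf hZ]
    simp [inner_add_left, inner_smul_left, inner_smul_right, innerField, innerField_comm Z]
    ring
  add {Z Z'} hZ hZ' := by
    have : CompleteSpace E := FiniteDimensional.complete ℝ E
    simp only [koszul, innerField_comm _ (Z + Z'), innerField_add_left]
    rw [mvfderiv_add (mdiffAt_innerField hZ hY) (mdiffAt_innerField hZ' hY),
      mvfderiv_add (mdiffAt_innerField hZ hX) (mdiffAt_innerField hZ' hX),
      VectorField.mlieBracket_add_right hZ hZ', VectorField.mlieBracket_add_right hZ hZ']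
    simp [inner_add_left, inner_add_right, innerField_comm Z, innerField_comm Z']
    ring

open Classical in
/-- `(v, w) ↦ ⟨∇_v Y, w⟩` at the point `x`, as a bilinear form (`0` if `Y` is not differentiable
at `x`). -/
def koszulForm (Y : ∀ x : M, TangentSpace I x) (x : M) :
    TangentSpace I x →L[ℝ] TangentSpace I x →L[ℝ] ℝ :=
  if hY : MDiffAt (T% Y) x then
    TensorialAt.mkHom₂ (fun X Z => koszul X Y Z x) x
      (fun _ hZ => tensorialAt_koszul_left hY hZ) (fun _ hX => tensorialAt_koszul_right hX hY)
  else 0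

theorem koszulForm_apply {X Y Z : ∀ x : M, TangentSpace I x} {x : M}
    (hX : MDiffAt (T% X) x) (hY : MDiffAt (T% Y) x) (hZ : MDiffAt (T% Z) x) :
    koszulForm Y x (X x) (Z x) = koszul X Y Z x := by
  rw [koszulForm, dif_pos hY, TensorialAt.mkHom₂_apply _ _ hX hZ]

/-- `∇Y` at `x`: the endomorphism `v ↦ ∇_v Y` with `⟨∇_v Y, w⟩ = koszulForm Y x v w`. -/
def leviCivitaFun (Y : ∀ x : M, TangentSpace I x) (x : M) :
    TangentSpace I x →L[ℝ] TangentSpace I x :=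
  LinearMap.toContinuousLinearMap
    { toFun := fun v =>
        (InnerProductSpace.toDual ℝ (TangentSpace I x)).symm (koszulForm Y x v)
      map_add' := by simp
      map_smul' := by simp }

theorem inner_leviCivitaFun (Y : ∀ x : M, TangentSpace I x) (x : M)
    (v w : TangentSpace I x) :
    inner ℝ (leviCivitaFun Y x v) w = koszulForm Y x v w := by
  simp [leviCivitaFun]

theorem inner_leviCivitaFun_eq {X Y Z : ∀ x : M, TangentSpace I x} {x : M}
    (hX : MDiffAt (T% X) x) (hY : MDiffAt (T% Y) x) (hZ : MDiffAt (T% Z) x) :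
    inner ℝ (leviCivitaFun Y x (X x)) (Z x) = koszul X Y Z x := by
  rw [inner_leviCivitaFun, koszulForm_apply hX hY hZ]

/-- The Levi-Civita connection of the Riemannian manifold `M`. -/
def leviCivita {E : Type*} [NormedAddCommGroup E] [NormedSpace ℝ E] [FiniteDimensional ℝ E]
    {H : Type*} [TopologicalSpace H] (I : ModelWithCorners ℝ E H) (M : Type*)
    [TopologicalSpace M] [ChartedSpace H M]
    [RiemannianBundle (fun x : M => TangentSpace I x)] [IsManifold I ∞ M]
    [IsContMDiffRiemannianBundle I ∞ E
      (fun x : M => TangentSpace I x)] :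
    CovariantDerivative I E
      (fun x : M => TangentSpace I x) where
  toFun := leviCivitaFun
  isCovariantDerivativeOnUniv :=
    { add := by
        intro Y Y' x hY hY' _
        have : CompleteSpace E := FiniteDimensional.complete ℝ E
        refine leviCivitaFun_ext fun X Z hX hZ => ?_
        rw [inner_leviCivitaFun_eq hX (mdifferentiableAt_add_section hY hY') hZ,
          add_apply, inner_add_left, inner_leviCivitaFun_eq hX hY hZ,
          inner_leviCivitaFun_eq hX hY' hZ]
        simp only [koszul, innerField_comm X (Y + Y'), innerField_add_left]
        rw [mvfderiv_add (mdiffAt_innerField hY hZ) (mdiffAt_innerField hY' hZ),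
          mvfderiv_add (mdiffAt_innerField hY hX) (mdiffAt_innerField hY' hX),
          VectorField.mlieBracket_add_right hY hY', VectorField.mlieBracket_add_left hY hY']
        simp [inner_add_left, inner_add_right, innerField_comm X]
        ring
      leibniz := by
        intro Y f x hY hf _
        have : CompleteSpace E := FiniteDimensional.complete ℝ E
        refine leviCivitaFun_ext fun X Z hX hZ => ?_
        rw [inner_leviCivitaFun_eq hX (hf.smul_section hY) hZ,
          add_apply, inner_add_left, smul_apply,
          real_inner_smul_left, inner_leviCivitaFun_eq hX hY hZ]
        simp only [koszul, innerField_comm X (f • Y), innerField_smul_left]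
        rw [mvfderiv_mul hf (mdiffAt_innerField hY hZ), mvfderiv_mul hf (mdiffAt_innerField hY hX),
          VectorField.mlieBracket_smul_right hf hY, VectorField.mlieBracket_smul_left hf hY]
        simp [inner_add_left, inner_smul_left, inner_smul_right, innerField, innerField_comm X]
        ring }


theorem leviCivita_metric {X Y Z : ∀ x : M, TangentSpace I x} {x : M}
    (hX : MDiffAt (T% X) x) (hY : MDiffAt (T% Y) x) (hZ : MDiffAt (T% Z) x) :
    mvfderiv I (innerField Y Z) x (X x) =
      inner ℝ (leviCivita I M Y x (X x)) (Z x) + inner ℝ (Y x) (leviCivita I M Z x (X x)) := by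
  rw [real_inner_comm (leviCivita I M Z x (X x)) (Y x)]
  simp only [leviCivita]
  rw [inner_leviCivitaFun_eq hX hY hZ, inner_leviCivitaFun_eq hX hZ hY]
  simp only [koszul, VectorField.mlieBracket_swap_apply (V := Z) (W := Y), innerField_comm Z Y,
    inner_neg_left]
  ring

theorem leviCivita_torsion : (leviCivita I M).torsion = 0 := by
  have : CompleteSpace E := FiniteDimensional.complete ℝ E
  rw [CovariantDerivative.torsion_eq_zero_iff]
  intro X Y x hX hY
  refine ext_inner_right ℝ fun w => ?_
  have hZ := FiberBundle.mdifferentiableAt_extend I E (V := fun x : M => TangentSpace I x) w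
  rw [← FiberBundle.extend_apply_self E w, inner_sub_left]
  simp only [leviCivita]
  rw [inner_leviCivitaFun_eq hX hY hZ, inner_leviCivitaFun_eq hY hX hZ]
  simp only [koszul, VectorField.mlieBracket_swap_apply (V := Y) (W := X), innerField_comm Y X,
    inner_neg_left]
  ring

end LeviCivita

section Geometry

variable {E : Type*} [NormedAddCommGroup E] [NormedSpace ℝ E] [FiniteDimensional ℝ E]
  {H : Type*} [TopologicalSpace H]
  {I : ModelWithCorners ℝ E H} {M : Type*} [TopologicalSpace M] [ChartedSpace H M]
  [RiemannianBundle (fun x : M => TangentSpace I x)] [IsManifold I ∞ M]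
  [IsContMDiffRiemannianBundle I ∞ E (fun x : M => TangentSpace I x)]

/-- The curvature `R(u, v)w = ∇_U ∇_V W - ∇_V ∇_U W - ∇_[U, V] W` at `x`, where `U`, `V`, `W` are
vector fields extending `u`, `v`, `w`, smooth near `x`. -/
def curvature (x : M) (u v w : TangentSpace I x) : TangentSpace I x :=
  let U : ∀ y : M, TangentSpace I y := FiberBundle.extend E u
  let V : ∀ y : M, TangentSpace I y := FiberBundle.extend E v
  let W : ∀ y : M, TangentSpace I y := FiberBundle.extend E w
  leviCivita I M (fun y => leviCivita I M W y (V y)) x u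
    - leviCivita I M (fun y => leviCivita I M W y (U y)) x v
    - leviCivita I M W x (VectorField.mlieBracket I U V x)

/-- The second fundamental form `B(v, w) = (∇_v W)^⊥` of a distribution `D`, for `v w : D x`.
Here `W` is a local section of `D` through `w`, namely the orthogonal projection to `D` of a
vector field extending `w`, and `⊥` is the orthogonal projection to the orthogonal complement
of `D x`. -/
def secondFundamentalForm (D : ∀ x : M, Submodule ℝ (TangentSpace I x)) (x : M) (v w : D x) :
    TangentSpace I x :=
  (D x)ᗮ.starProjection
    (leviCivita I M
      (fun y => (D y).starProjection (FiberBundle.extend E (w : TangentSpace I x) y)) x v)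

/-- `‖B‖² = ∑_{i,j} ‖B(e_i, e_j)‖²` at `x`, for an orthonormal basis `e_i` of `D x`. -/
def normSqSecondFundamentalForm (D : ∀ x : M, Submodule ℝ (TangentSpace I x)) (x : M) : ℝ :=
  ∑ i, ∑ j, ‖secondFundamentalForm D x (stdOrthonormalBasis ℝ (D x) i)
    (stdOrthonormalBasis ℝ (D x) j)‖ ^ 2

/-- The mean curvature vector `h = ∑_i B(e_i, e_i) = ∑_i (∇_{e_i} e_i)^⊥` at `x` (not divided by
the dimension), for an orthonormal basis `e_i` of `D x`. -/
def meanCurvatureVector (D : ∀ x : M, Submodule ℝ (TangentSpace I x)) (x : M) :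
    TangentSpace I x :=
  ∑ i, secondFundamentalForm D x (stdOrthonormalBasis ℝ (D x) i) (stdOrthonormalBasis ℝ (D x) i)

/-- The mixed scalar curvature `K(D, D') = ∑_{i,α} ⟨R(e_α, e_i) e_i, e_α⟩` at `x`, for orthonormal
bases `e_i` of `D x` and `e_α` of `D' x`. -/
def mixedScalarCurvature (D D' : ∀ x : M, Submodule ℝ (TangentSpace I x)) (x : M) : ℝ :=
  ∑ i, ∑ α, inner ℝ
    (curvature x (stdOrthonormalBasis ℝ (D' x) α : TangentSpace I x)
      (stdOrthonormalBasis ℝ (D x) i) (stdOrthonormalBasis ℝ (D x) i))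
    (stdOrthonormalBasis ℝ (D' x) α : TangentSpace I x)

end Geometry

section Volume

variable {d : ℕ} {M : Type*} [TopologicalSpace M] [ChartedSpace (EuclideanSpace ℝ (Fin d)) M]
  [RiemannianBundle (fun x : M => TangentSpace (𝓡 d) x)]

/-- The vector field `∂_i` of the chart `φ`, at the point `φ⁻¹ u`. -/
def coordField (φ : OpenPartialHomeomorph M (EuclideanSpace ℝ (Fin d)))
    (u : EuclideanSpace ℝ (Fin d)) (i : Fin d) : TangentSpace (𝓡 d) (φ.symm u) :=
  mfderiv (𝓡 d) (𝓡 d) φ.symm u (EuclideanSpace.single i (1 : ℝ) : EuclideanSpace ℝ (Fin d))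

/-- The matrix `g_ij = ⟨∂_i, ∂_j⟩` of the metric in the chart `φ`. -/
def metricMatrix (φ : OpenPartialHomeomorph M (EuclideanSpace ℝ (Fin d)))
    (u : EuclideanSpace ℝ (Fin d)) : Matrix (Fin d) (Fin d) ℝ :=
  Matrix.of fun i j => inner ℝ (coordField φ u i) (coordField φ u j)

/-- The Riemannian volume on the domain of the chart `φ`: the image under `φ⁻¹` of the measure
`√(det g_ij) du` on the target of `φ`. -/
def chartVolume [MeasurableSpace M] (φ : OpenPartialHomeomorph M (EuclideanSpace ℝ (Fin d))) :
    Measure M :=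
  ((volume.restrict φ.target).withDensity
    fun u => ENNReal.ofReal (Real.sqrt (metricMatrix φ u).det)).map φ.symm

/-- The Riemannian volume measure: the measures `chartVolume φ` agree on overlaps of charts, and
their supremum is the measure that restricts to `chartVolume φ` on the domain of every chart. -/
def riemannianVolume (d : ℕ) (M : Type*) [TopologicalSpace M]
    [ChartedSpace (EuclideanSpace ℝ (Fin d)) M]
    [RiemannianBundle (fun x : M => TangentSpace (𝓡 d) x)] [MeasurableSpace M] : Measure M :=
  ⨆ φ ∈ atlas (EuclideanSpace ℝ (Fin d)) M, chartVolume φ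

end Volume

/-- A `C^∞` foliation with `k`-dimensional leaves of the `d`-dimensional manifold `M`: a set of
charts of the smooth structure, covering `M`, whose transition maps are locally of the form
`(a, b) ↦ (f(a, b), g(b))`, where `a` stands for the first `k` coordinates and `b` for the last
`d - k` ones. -/
structure Foliation (d k : ℕ) (M : Type*) [TopologicalSpace M]
    [ChartedSpace (EuclideanSpace ℝ (Fin d)) M] where
  le_dim : k ≤ d
  charts : Set (OpenPartialHomeomorph M (EuclideanSpace ℝ (Fin d)))
  charts_subset : charts ⊆ IsManifold.maximalAtlas (𝓡 d) ∞ M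
  cover : ∀ x : M, ∃ φ ∈ charts, x ∈ φ.source
  compatible : ∀ φ ∈ charts, ∀ ψ ∈ charts, ∀ u ∈ (φ.symm.trans ψ).source,
    ∃ V ∈ 𝓝 u, ∀ a ∈ V, ∀ b ∈ V, (∀ i : Fin d, k ≤ i → a i = b i) →
      ∀ i : Fin d, k ≤ i → ψ (φ.symm a) i = ψ (φ.symm b) i

/-- The tangent space at `x` of the leaf through `x`: the vectors that are annihilated by the
differentials of the last `d - k` coordinates of the foliated charts around `x`. -/
def Foliation.tangent {d k : ℕ} {M : Type*} [TopologicalSpace M]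
    [ChartedSpace (EuclideanSpace ℝ (Fin d)) M] (F : Foliation d k M) (x : M) :
    Submodule ℝ (TangentSpace (𝓡 d) x) where
  carrier := {v | ∀ φ ∈ F.charts, x ∈ φ.source → ∀ i : Fin d, k ≤ i →
    mvfderiv (𝓡 d) (fun y => φ y i) x v = 0}
  add_mem' := by
    intro v w hv hw φ hφ hx i hi
    rw [map_add, hv φ hφ hx i hi, hw φ hφ hx i hi, add_zero]
  zero_mem' := by
    intro φ _ _ i _
    rw [map_zero]
  smul_mem' := by
    intro c v hv φ hφ hx i hi
    rw [map_smul, hv φ hφ hx i hi, smul_zero]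

end

/-!
Write `D` and `D'` for the tangent distributions of the two foliations and `h`, `h'` for their mean
curvature vectors. The integrand is the divergence of the globally defined smooth vector field
`h + h'`, so that the divergence theorem on the closed manifold `M` gives the result.

The pointwise identity is `IsAdaptedFrameOn.divergence_meanCurvatureVector_add`. In a local
orthonormal frame adapted to `D` and `D'`, everything is expressed by the connection coefficients
`⟨∇_{e_a} e_b, e_c⟩`. The derivatives of the coefficients that occur in the mixed curvature are those
that occur in the divergence of `h + h'`. The quadratic terms are compared by
`sum_connection_products`, which uses the skew-symmetry of the coefficients in `b`, `c` and, from
Frobenius integrability (the bracket of two fields of `D` is in `D`), the symmetry of the second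
fundamental forms. Adapted frames exist (`exists_isAdaptedFrameOn`): the first coordinate fields of a
foliated chart span the tangent distribution of the foliation, and Gram-Schmidt makes them
orthonormal. Since the two foliations are orthogonal and of complementary dimensions, the two
frames together form a frame of `M`.

The divergence theorem (`integral_divergence`) is proved in charts. With `g` the Gram matrix of the
coordinate fields, `√g div W = ∑_j ∂_j (√g W^j)` (`chartDensity_mul_divergence`, by Jacobi's formula
for the derivative of a determinant), and the integral of the right-hand side vanishes if `W` has
compact support in the chart. The Riemannian volume, a supremum of chart volumes, restricts to the
chart volume on each chart of the atlas (`restrict_riemannianVolume`), because the densities of two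
charts differ by the absolute Jacobian determinant. A partition of unity reduces the general case to
that of one chart.
-/

noncomputable section

/-! ### Vector fields and functions that are smooth on an open set -/

section Calculus

variable {E : Type*} [NormedAddCommGroup E] [NormedSpace ℝ E]
  {H : Type*} [TopologicalSpace H]
  {I : ModelWithCorners ℝ E H} {M : Type*} [TopologicalSpace M] [ChartedSpace H M]

theorem ContMDiffOn.mdiffAt_of_isOpen {E' : Type*} [NormedAddCommGroup E'] [NormedSpace ℝ E']
    {H' : Type*} [TopologicalSpace H'] {I' : ModelWithCorners ℝ E' H'} {N : Type*}
    [TopologicalSpace N] [ChartedSpace H' N] {f : M → N} {U : Set M} {x : M}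
    (hf : ContMDiffOn I I' ∞ f U) (hU : IsOpen U) (hx : x ∈ U) : MDifferentiableAt I I' f x :=
  (hf.contMDiffAt (hU.mem_nhds hx)).mdifferentiableAt (by simp)

theorem mdiffAt_finset_sum {ι : Type*} {s : Finset ι} {f : ι → M → ℝ} {x : M}
    (hf : ∀ i ∈ s, MDiffAt (f i) x) : MDiffAt (fun y => ∑ i ∈ s, f i y) x := by
  classical
  induction s using Finset.induction_on with
  | empty => simpa using mdifferentiableAt_const
  | insert a s ha h =>
    simp only [Finset.mem_insert, forall_eq_or_imp] at hf
    simp only [Finset.sum_insert ha]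
    exact hf.1.add (h hf.2)

theorem mvfderiv_finset_sum {ι : Type*} {s : Finset ι} {f : ι → M → ℝ} {x : M}
    (hf : ∀ i ∈ s, MDiffAt (f i) x) :
    mvfderiv I (fun y => ∑ i ∈ s, f i y) x = ∑ i ∈ s, mvfderiv I (f i) x := by
  classical
  induction s using Finset.induction_on with
  | empty => simp [mvfderiv_const]
  | insert a s ha h =>
    simp only [Finset.mem_insert, forall_eq_or_imp] at hf
    simp only [Finset.sum_insert ha, ← h hf.2]
    exact mvfderiv_add hf.1 (mdiffAt_finset_sum hf.2)

variable [IsManifold I ∞ M]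

/-- The derivative of a smooth function along a smooth field is smooth. -/
theorem contMDiffOn_mvfderiv_apply {f : M → ℝ} {X : ∀ x : M, TangentSpace I x} {U : Set M}
    (hU : IsOpen U) (hf : CMDiff[U] ∞ f) (hX : CMDiff[U] ∞ (T% X)) :
    CMDiff[U] ∞ (fun y => mvfderiv I f y (X y)) := by
  have h := (hf.contMDiffOn_tangentMapWithin (m := ∞) (by simp) hU.uniqueMDiffOn).comp hX
    (fun y hy => hy)
  intro x hx
  have h3 := ((contMDiffWithinAt_totalSpace (E := fun x : ℝ => TangentSpace 𝓘(ℝ, ℝ) x)).1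
    (h x hx)).2
  refine h3.congr (fun y hy => ?_) ?_
  · simp [tangentMapWithin, mvfderiv, mfderivWithin_of_isOpen hU hy]
    rfl
  · simp [tangentMapWithin, mvfderiv, mfderivWithin_of_isOpen hU hx]
    rfl

theorem exists_isOpen_contMDiffOn_extend {x : M} {U : Set M} (hU : IsOpen U) (hx : x ∈ U)
    (v : TangentSpace I x) :
    ∃ W ⊆ U, IsOpen W ∧ x ∈ W ∧
      CMDiff[W] ∞ (T% (FiberBundle.extend E v : ∀ y : M, TangentSpace I y)) := by
  obtain ⟨s, hs, hsv⟩ := FiberBundle.exists_contMDiffOn_extend (k := ∞) I E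
    (V := fun x : M => TangentSpace I x) v
  obtain ⟨t, hts, ht, hxt⟩ := mem_nhds_iff.1 hs
  exact ⟨U ∩ t, Set.inter_subset_left, hU.inter ht, ⟨hx, hxt⟩,
    hsv.mono (Set.inter_subset_right.trans hts)⟩

omit [IsManifold I ∞ M] in
theorem mvfderiv_congr {f g : M → ℝ} {x : M} (h : f =ᶠ[𝓝 x] g) :
    mvfderiv I f x = mvfderiv I g x := by
  have hx := h.eq_of_nhds
  ext v
  simp only [mvfderiv, h.mfderiv_eq]
  rfl

variable [CompleteSpace E]

theorem contMDiffOn_mlieBracket {X Y : ∀ x : M, TangentSpace I x} {U : Set M}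
    (hU : IsOpen U) (hX : CMDiff[U] ∞ (T% X)) (hY : CMDiff[U] ∞ (T% Y)) :
    CMDiff[U] ∞ (T% (VectorField.mlieBracket I X Y)) := by
  intro x hx
  have : IsManifold I ((⊤ : ℕ∞) + 1) M := by simpa using ‹IsManifold I ∞ M›
  have : IsManifold I (minSmoothness ℝ 2) M := by
    simp only [minSmoothness_of_isRCLikeNormedField]; infer_instance
  exact (ContMDiffAt.mlieBracket_vectorField (m := ⊤) (n := ⊤) (hX.contMDiffAt (hU.mem_nhds hx))
    (hY.contMDiffAt (hU.mem_nhds hx)) (by simp)).contMDiffWithinAt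

/-- Leibniz rule for the bracket with a smooth multiple of a smooth field, on an open set. -/
theorem mlieBracket_smul_right_of_isOpen {f : M → ℝ} {X Z : ∀ x : M, TangentSpace I x} {U : Set M}
    (hU : IsOpen U) (hf : CMDiff[U] ∞ f) (hZ : CMDiff[U] ∞ (T% Z)) {y : M} (hy : y ∈ U) :
    VectorField.mlieBracket I X (f • Z) y =
      ((fun z => mvfderiv I f z (X z)) • Z + f • VectorField.mlieBracket I X Z) y :=
  VectorField.mlieBracket_smul_right (hf.mdiffAt_of_isOpen hU hy) (hZ.mdiffAt_of_isOpen hU hy)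

/-- The bracket acts on functions as a commutator. The Jacobi identity for `X`, `Y` and `f • Z`,
minus `f` times the Jacobi identity for `X`, `Y`, `Z`, is `([X, Y] f - X (Y f) + Y (X f)) • Z = 0`. -/
theorem mvfderiv_mlieBracket
    {f : M → ℝ} {X Y : ∀ x : M, TangentSpace I x} {U : Set M}
    (hU : IsOpen U) (hf : CMDiff[U] ∞ f) (hX : CMDiff[U] ∞ (T% X)) (hY : CMDiff[U] ∞ (T% Y))
    {x : M} (hx : x ∈ U) :
    mvfderiv I f x (VectorField.mlieBracket I X Y x) =
      mvfderiv I (fun y => mvfderiv I f y (Y y)) x (X x)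
        - mvfderiv I (fun y => mvfderiv I f y (X y)) x (Y x) := by
  -- The Jacobi argument needs a nonzero vector `Z x`.
  by_cases hv : ∀ v : TangentSpace I x, v = 0
  · rw [hv (VectorField.mlieBracket I X Y x), hv (X x), hv (Y x)]
    simp
  push Not at hv
  obtain ⟨v, hv⟩ := hv
  obtain ⟨W, hWU, hW, hxW, hZ⟩ := exists_isOpen_contMDiffOn_extend hU hx v
  have hZx : (FiberBundle.extend E v : ∀ y : M, TangentSpace I y) x = v := by simp
  set Z : ∀ y : M, TangentSpace I y := FiberBundle.extend E v
  replace hf := hf.mono hWU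
  replace hX := hX.mono hWU
  replace hY := hY.mono hWU
  have key : ∀ X Y : ∀ x : M, TangentSpace I x, CMDiff[W] ∞ (T% X) → CMDiff[W] ∞ (T% Y) →
      VectorField.mlieBracket I X (VectorField.mlieBracket I Y (f • Z)) x =
        mvfderiv I (fun y => mvfderiv I f y (Y y)) x (X x) • Z x
        + mvfderiv I f x (Y x) • VectorField.mlieBracket I X Z x
        + (mvfderiv I f x (X x) • VectorField.mlieBracket I Y Z x
        + f x • VectorField.mlieBracket I X (VectorField.mlieBracket I Y Z) x) := by
    intro X Y hX hY
    have hYZ := contMDiffOn_mlieBracket hW hY hZ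
    have hYf := contMDiffOn_mvfderiv_apply hW hf hY
    have e1 : VectorField.mlieBracket I Y (f • Z) =ᶠ[𝓝 x]
        ((fun z => mvfderiv I f z (Y z)) • Z + f • VectorField.mlieBracket I Y Z) := by
      filter_upwards [hW.mem_nhds hxW] with y hy
      exact mlieBracket_smul_right_of_isOpen hW hf hZ hy
    rw [Filter.EventuallyEq.rfl.mlieBracket_vectorField_eq e1,
      VectorField.mlieBracket_add_right
        ((hYf.smul_section hZ).mdiffAt_of_isOpen hW hxW)
        ((hf.smul_section hYZ).mdiffAt_of_isOpen hW hxW),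
      mlieBracket_smul_right_of_isOpen hW hYf hZ hxW,
      mlieBracket_smul_right_of_isOpen hW hf hYZ hxW]
    rfl
  have : IsManifold I (minSmoothness ℝ 3) M := by
    simp only [minSmoothness_of_isRCLikeNormedField]; infer_instance
  have h2 : minSmoothness ℝ 2 ≤ (∞ : ℕ∞ω) := by
    rw [minSmoothness_of_isRCLikeNormedField]; exact ENat.LEInfty.out
  have J : ∀ Z : ∀ x : M, TangentSpace I x, CMDiff[W] ∞ (T% Z) → _ := fun Z hZ =>
    VectorField.leibniz_identity_mlieBracket_apply (x := x)
    (((hX.contMDiffAt (hW.mem_nhds hxW))).of_le h2)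
    (((hY.contMDiffAt (hW.mem_nhds hxW))).of_le h2)
    (((hZ.contMDiffAt (hW.mem_nhds hxW))).of_le h2)
  have J1 := J Z hZ
  have J2 := J (f • Z) (hf.smul_section hZ)
  rw [key X Y hX hY, key Y X hY hX, mlieBracket_smul_right_of_isOpen hW hf hZ hxW, J1] at J2
  simp only [Pi.add_apply, Pi.smul_apply', hZx] at J2
  rw [← sub_eq_zero] at J2
  have h0 : (mvfderiv I (fun y => mvfderiv I f y (Y y)) x (X x)
      - mvfderiv I (fun y => mvfderiv I f y (X y)) x (Y x)
      - mvfderiv I f x (VectorField.mlieBracket I X Y x)) • v = 0 := by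
    rw [← J2]; module
  have := (smul_eq_zero.1 h0).resolve_right hv
  linarith

end Calculus

/-! ### The Levi-Civita connection on smooth fields -/

section LeviCivita

variable {E : Type*} [NormedAddCommGroup E] [NormedSpace ℝ E] [FiniteDimensional ℝ E]
  {H : Type*} [TopologicalSpace H]
  {I : ModelWithCorners ℝ E H} {M : Type*} [TopologicalSpace M] [ChartedSpace H M]
  [RiemannianBundle (fun x : M => TangentSpace I x)] [IsManifold I ∞ M]
  [IsContMDiffRiemannianBundle I ∞ E (fun x : M => TangentSpace I x)]

omit [FiniteDimensional ℝ E] in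
theorem contMDiffOn_innerField {X Y : ∀ x : M, TangentSpace I x} {U : Set M}
    (hX : CMDiff[U] ∞ (T% X)) (hY : CMDiff[U] ∞ (T% Y)) : CMDiff[U] ∞ (innerField X Y) :=
  ContMDiffOn.inner_bundle (IB := I) (F := E) (E := fun x : M => TangentSpace I x)
    (b := fun x : M => x) hX hY

theorem contMDiffOn_koszul {X Y Z : ∀ x : M, TangentSpace I x} {U : Set M} (hU : IsOpen U)
    (hX : CMDiff[U] ∞ (T% X)) (hY : CMDiff[U] ∞ (T% Y)) (hZ : CMDiff[U] ∞ (T% Z)) :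
    CMDiff[U] ∞ (koszul X Y Z) := by
  have : CompleteSpace E := FiniteDimensional.complete ℝ E
  have h1 := contMDiffOn_mvfderiv_apply hU (contMDiffOn_innerField hY hZ) hX
  have h2 := contMDiffOn_mvfderiv_apply hU (contMDiffOn_innerField hX hZ) hY
  have h3 := contMDiffOn_mvfderiv_apply hU (contMDiffOn_innerField hX hY) hZ
  have h4 := contMDiffOn_innerField (contMDiffOn_mlieBracket hU hX hY) hZ
  have h5 := contMDiffOn_innerField (contMDiffOn_mlieBracket hU hX hZ) hY
  have h6 := contMDiffOn_innerField (contMDiffOn_mlieBracket hU hY hZ) hX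
  exact contMDiffOn_const.mul (((((h1.add h2).sub h3).add h4).sub h5).sub h6)

theorem inner_leviCivita {X Y Z : ∀ x : M, TangentSpace I x} {x : M}
    (hX : MDiffAt (T% X) x) (hY : MDiffAt (T% Y) x) (hZ : MDiffAt (T% Z) x) :
    inner ℝ (leviCivita I M Y x (X x)) (Z x) = koszul X Y Z x :=
  inner_leviCivitaFun_eq hX hY hZ

/-- The Levi-Civita connection is torsion-free. -/
theorem leviCivita_sub_leviCivita {X Y : ∀ x : M, TangentSpace I x} {x : M}
    (hX : MDiffAt (T% X) x) (hY : MDiffAt (T% Y) x) :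
    leviCivita I M Y x (X x) - leviCivita I M X x (Y x) = VectorField.mlieBracket I X Y x := by
  have : CompleteSpace E := FiniteDimensional.complete ℝ E
  exact (leviCivita I M).torsion_eq_zero_iff.1 leviCivita_torsion hX hY

theorem leviCivita_congr {X Y : ∀ x : M, TangentSpace I x} {x : M}
    (hX : MDiffAt (T% X) x) (hY : MDiffAt (T% Y) x) (h : ∀ᶠ y in 𝓝 x, X y = Y y) :
    leviCivita I M X x = leviCivita I M Y x :=
  (leviCivita I M).isCovariantDerivativeOnUniv.congr_of_eventuallyEq hX hY Filter.univ_mem h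

theorem leviCivita_smul {f : M → ℝ} {X : ∀ x : M, TangentSpace I x} {x : M}
    (hf : MDiffAt f x) (hX : MDiffAt (T% X) x) (v : TangentSpace I x) :
    leviCivita I M (f • X) x v = f x • leviCivita I M X x v + mvfderiv I f x v • X x := by
  rw [(leviCivita I M).isCovariantDerivativeOnUniv.leibniz hX hf]
  rfl

theorem leviCivita_add {X Y : ∀ x : M, TangentSpace I x} {x : M}
    (hX : MDiffAt (T% X) x) (hY : MDiffAt (T% Y) x) :
    leviCivita I M (X + Y) x = leviCivita I M X x + leviCivita I M Y x :=
  (leviCivita I M).isCovariantDerivativeOnUniv.add hX hY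

theorem leviCivita_sum {ι : Type*} {s : Finset ι} {X : ι → ∀ x : M, TangentSpace I x}
    {x : M} (hX : ∀ i ∈ s, MDiffAt (T% (X i)) x) :
    leviCivita I M (fun y => ∑ i ∈ s, X i y) x = ∑ i ∈ s, leviCivita I M (X i) x := by
  classical
  induction s using Finset.induction_on with
  | empty =>
    simp only [Finset.sum_empty]
    exact congrFun (CovariantDerivative.zero (leviCivita I M)) x
  | insert a s ha h =>
    simp only [Finset.mem_insert, forall_eq_or_imp] at hX
    simp only [Finset.sum_insert ha, ← h hX.2]
    exact leviCivita_add hX.1 (.sum_section hX.2)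

/-- Differentiation of a linear combination of fields with smooth coefficients. -/
theorem leviCivita_sum_smul {ι : Type*} {s : Finset ι} {f : ι → M → ℝ}
    {X : ι → ∀ x : M, TangentSpace I x} {x : M} (hf : ∀ i ∈ s, MDiffAt (f i) x)
    (hX : ∀ i ∈ s, MDiffAt (T% (X i)) x) (v : TangentSpace I x) :
    leviCivita I M (fun y => ∑ i ∈ s, f i y • X i y) x v =
      ∑ i ∈ s, (f i x • leviCivita I M (X i) x v + mvfderiv I (f i) x v • X i x) := by
  have h := leviCivita_sum (X := fun i => f i • X i) fun i hi => (hf i hi).smul_section (hX i hi)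
  simp only [Pi.smul_apply'] at h
  rw [h, sum_apply]
  exact Finset.sum_congr rfl fun i hi => leviCivita_smul (hf i hi) (hX i hi) v

end LeviCivita

/-! ### Orthonormal frames and curvature -/

section Frame

set_option linter.unusedSectionVars false

variable {E : Type*} [NormedAddCommGroup E] [NormedSpace ℝ E] [FiniteDimensional ℝ E]
  {H : Type*} [TopologicalSpace H]
  {I : ModelWithCorners ℝ E H} {M : Type*} [TopologicalSpace M] [ChartedSpace H M]
  [RiemannianBundle (fun x : M => TangentSpace I x)] [IsManifold I ∞ M]
  [IsContMDiffRiemannianBundle I ∞ E (fun x : M => TangentSpace I x)]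
  {τ : Type*} [Fintype τ] {e : τ → ∀ x : M, TangentSpace I x} {U : Set M} {x : M}

/-- The fields `e a` are smooth on `U` and form an orthonormal basis of the tangent space at every
point of `U`. -/
structure IsOrthonormalFrameOn (e : τ → ∀ x : M, TangentSpace I x) (U : Set M) : Prop where
  contMDiffOn : ∀ a, CMDiff[U] ∞ (T% (e a))
  orthonormal : ∀ x ∈ U, Orthonormal ℝ fun a => e a x
  span : ∀ x ∈ U, ⊤ ≤ Submodule.span ℝ (Set.range fun a => e a x)

/-- The connection coefficients `⟨∇_{e a} (e b), e c⟩` of an orthonormal frame. -/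
def connCoeff (e : τ → ∀ x : M, TangentSpace I x) (a b c : τ) : M → ℝ :=
  koszul (e a) (e b) (e c)

/-- The curvature expression `∇_X ∇_Y W - ∇_Y ∇_X W - ∇_[X, Y] W` of three vector fields. -/
def curvatureField (X Y W : ∀ x : M, TangentSpace I x) (x : M) : TangentSpace I x :=
  leviCivita I M (fun y => leviCivita I M W y (Y y)) x (X x)
    - leviCivita I M (fun y => leviCivita I M W y (X y)) x (Y x)
    - leviCivita I M W x (VectorField.mlieBracket I X Y x)

theorem curvature_eq_curvatureField (x : M) (u v w : TangentSpace I x) :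
    curvature x u v w = curvatureField (FiberBundle.extend E u) (FiberBundle.extend E v)
      (FiberBundle.extend E w) x := by
  simp [curvature, curvatureField]

theorem curvatureField_swap (X Y W : ∀ x : M, TangentSpace I x) (x : M) :
    curvatureField X Y W x = - curvatureField Y X W x := by
  simp only [curvatureField, VectorField.mlieBracket_swap_apply (V := X) (W := Y), map_neg]
  abel

namespace IsOrthonormalFrameOn

/-- The orthonormal basis of the tangent space given by a frame. -/
def basis (he : IsOrthonormalFrameOn e U) (hx : x ∈ U) :
    OrthonormalBasis τ ℝ (TangentSpace I x) :=
  OrthonormalBasis.mk (he.orthonormal x hx) (he.span x hx)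

theorem basis_apply (he : IsOrthonormalFrameOn e U) (hx : x ∈ U) (a : τ) :
    he.basis hx a = e a x := by
  simp [basis]

theorem sum_inner_smul (he : IsOrthonormalFrameOn e U) (hx : x ∈ U) (v : TangentSpace I x) :
    ∑ a, (inner ℝ (e a x) v : ℝ) • e a x = v := by
  simpa [basis_apply] using (he.basis hx).sum_repr' v

theorem mdiffAt (he : IsOrthonormalFrameOn e U) (hU : IsOpen U) (hx : x ∈ U) (a : τ) :
    MDiffAt (T% (e a)) x :=
  (he.contMDiffOn a).mdiffAt_of_isOpen hU hx

/-- The covariant derivative in a frame, with the coefficients given by the Koszul formula. This is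
how smoothness of `∇_Y W` is obtained. -/
theorem leviCivita_eq_sum (he : IsOrthonormalFrameOn e U) (hU : IsOpen U)
    {W : ∀ x : M, TangentSpace I x} (hW : CMDiff[U] ∞ (T% W)) (hx : x ∈ U)
    (v : TangentSpace I x) :
    leviCivita I M W x v =
      ∑ c, (∑ a, (inner ℝ (e a x) v : ℝ) * koszul (e a) W (e c) x) • e c x := by
  have hWx := hW.mdiffAt_of_isOpen hU hx
  conv_lhs => rw [← he.sum_inner_smul hx (leviCivita I M W x v), ← he.sum_inner_smul hx v]
  refine Finset.sum_congr rfl fun c _ => ?_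
  rw [map_sum, inner_sum]
  congr 1
  refine Finset.sum_congr rfl fun a _ => ?_
  rw [map_smul, inner_smul_right, real_inner_comm _ (e c x),
    inner_leviCivita (he.mdiffAt hU hx a) hWx (he.mdiffAt hU hx c)]

/-- `∇_Y W` is as regular as `Y` when `W` is smooth. -/
theorem mdiffAt_leviCivita (he : IsOrthonormalFrameOn e U) (hU : IsOpen U)
    {W Y : ∀ x : M, TangentSpace I x} (hW : CMDiff[U] ∞ (T% W)) (hx : x ∈ U)
    (hY : MDiffAt (T% Y) x) :
    MDiffAt (T% (fun y => leviCivita I M W y (Y y))) x := by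
  have h : MDiffAt (T% (fun y => ∑ c, (∑ a, (innerField (e a) Y y) *
      koszul (e a) W (e c) y) • e c y)) x := by
    refine .sum_section fun c _ => MDifferentiableAt.smul_section ?_ (he.mdiffAt hU hx c)
    refine mdiffAt_finset_sum fun a _ => ?_
    exact (mdiffAt_innerField (he.mdiffAt hU hx a) hY).mul
      ((contMDiffOn_koszul hU (he.contMDiffOn a) hW (he.contMDiffOn c)).mdiffAt_of_isOpen hU hx)
  refine h.congr_of_eventuallyEq ?_
  filter_upwards [hU.mem_nhds hx] with y hy
  rw [he.leviCivita_eq_sum hU hW hy]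
  rfl

theorem contMDiffOn_leviCivita (he : IsOrthonormalFrameOn e U) (hU : IsOpen U)
    {W Y : ∀ x : M, TangentSpace I x} (hW : CMDiff[U] ∞ (T% W)) (hY : CMDiff[U] ∞ (T% Y)) :
    CMDiff[U] ∞ (T% (fun y => leviCivita I M W y (Y y))) := by
  have h : CMDiff[U] ∞ (T% (fun y => ∑ c, (∑ a, (innerField (e a) Y y) *
      koszul (e a) W (e c) y) • e c y)) := by
    refine .sum_section fun c _ => ContMDiffOn.smul_section ?_ (he.contMDiffOn c)
    refine contMDiffOn_finsetSum fun a _ => ?_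
    exact (contMDiffOn_innerField (he.contMDiffOn a) hY).mul
      (contMDiffOn_koszul hU (he.contMDiffOn a) hW (he.contMDiffOn c))
  refine h.congr fun y hy => ?_
  rw [he.leviCivita_eq_sum hU hW hy]
  rfl

/-- `⟨R(X, Y) W, Z⟩` with all second derivatives written as derivatives of functions. -/
theorem inner_curvatureField (he : IsOrthonormalFrameOn e U) (hU : IsOpen U)
    {X Y W Z : ∀ x : M, TangentSpace I x} (hX : CMDiff[U] ∞ (T% X)) (hY : CMDiff[U] ∞ (T% Y))
    (hW : CMDiff[U] ∞ (T% W)) (hZ : CMDiff[U] ∞ (T% Z)) (hx : x ∈ U) :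
    inner ℝ (curvatureField X Y W x) (Z x) =
      (mvfderiv I (koszul Y W Z) x (X x)
        - inner ℝ (leviCivita I M W x (Y x)) (leviCivita I M Z x (X x)))
      - (mvfderiv I (koszul X W Z) x (Y x)
        - inner ℝ (leviCivita I M W x (X x)) (leviCivita I M Z x (Y x)))
      - inner ℝ (leviCivita I M W x (VectorField.mlieBracket I X Y x)) (Z x) := by
  have key : ∀ X Y : ∀ x : M, TangentSpace I x, CMDiff[U] ∞ (T% X) → CMDiff[U] ∞ (T% Y) →
      inner ℝ (leviCivita I M (fun y => leviCivita I M W y (Y y)) x (X x)) (Z x) =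
      mvfderiv I (koszul Y W Z) x (X x)
        - inner ℝ (leviCivita I M W x (Y x)) (leviCivita I M Z x (X x)) := by
    intro X Y hX hY
    have h := leviCivita_metric (hX.mdiffAt_of_isOpen hU hx)
      ((he.contMDiffOn_leviCivita hU hW hY).mdiffAt_of_isOpen hU hx)
      (hZ.mdiffAt_of_isOpen hU hx)
    have h2 : innerField (fun y => leviCivita I M W y (Y y)) Z =ᶠ[𝓝 x] koszul Y W Z := by
      filter_upwards [hU.mem_nhds hx] with y hy
      exact inner_leviCivita (hY.mdiffAt_of_isOpen hU hy) (hW.mdiffAt_of_isOpen hU hy)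
        (hZ.mdiffAt_of_isOpen hU hy)
    rw [mvfderiv_congr h2] at h
    linarith
  rw [curvatureField, inner_sub_left, inner_sub_left, key X Y hX hY, key Y X hY hX]

/-- `R(X, Y)` is skew-adjoint: `[X, Y] - XY + YX` annihilates the function `⟨W, Z⟩`. -/
theorem inner_curvatureField_skew (he : IsOrthonormalFrameOn e U) (hU : IsOpen U)
    {X Y W Z : ∀ x : M, TangentSpace I x} (hX : CMDiff[U] ∞ (T% X)) (hY : CMDiff[U] ∞ (T% Y))
    (hW : CMDiff[U] ∞ (T% W)) (hZ : CMDiff[U] ∞ (T% Z)) (hx : x ∈ U) :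
    inner ℝ (curvatureField X Y W x) (Z x) = - inner ℝ (W x) (curvatureField X Y Z x) := by
  have : CompleteSpace E := FiniteDimensional.complete ℝ E
  rw [real_inner_comm _ (W x), he.inner_curvatureField hU hX hY hW hZ hx,
    he.inner_curvatureField hU hX hY hZ hW hx]
  have key : ∀ X Y : ∀ x : M, TangentSpace I x, CMDiff[U] ∞ (T% X) → CMDiff[U] ∞ (T% Y) →
      mvfderiv I (fun y => mvfderiv I (innerField W Z) y (Y y)) x (X x) =
      mvfderiv I (koszul Y W Z) x (X x) + mvfderiv I (koszul Y Z W) x (X x) := by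
    intro X Y hX hY
    have h2 : (fun y => mvfderiv I (innerField W Z) y (Y y)) =ᶠ[𝓝 x]
        (koszul Y W Z + koszul Y Z W) := by
      filter_upwards [hU.mem_nhds hx] with y hy
      rw [leviCivita_metric (hY.mdiffAt_of_isOpen hU hy) (hW.mdiffAt_of_isOpen hU hy)
        (hZ.mdiffAt_of_isOpen hU hy), real_inner_comm _ (W y)]
      rw [inner_leviCivita (hY.mdiffAt_of_isOpen hU hy) (hW.mdiffAt_of_isOpen hU hy)
        (hZ.mdiffAt_of_isOpen hU hy), inner_leviCivita (hY.mdiffAt_of_isOpen hU hy)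
        (hZ.mdiffAt_of_isOpen hU hy) (hW.mdiffAt_of_isOpen hU hy)]
      rfl
    rw [mvfderiv_congr h2, mvfderiv_add
      ((contMDiffOn_koszul hU hY hW hZ).mdiffAt_of_isOpen hU hx)
      ((contMDiffOn_koszul hU hY hZ hW).mdiffAt_of_isOpen hU hx)]
    rfl
  have hb := mvfderiv_mlieBracket hU (contMDiffOn_innerField hW hZ) hX hY hx
  rw [key X Y hX hY, key Y X hY hX, leviCivita_metric
    ((contMDiffOn_mlieBracket hU hX hY).mdiffAt_of_isOpen hU hx)
    (hW.mdiffAt_of_isOpen hU hx) (hZ.mdiffAt_of_isOpen hU hx)] at hb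
  rw [real_inner_comm (W x), real_inner_comm (leviCivita I M Z x (Y x)),
    real_inner_comm (leviCivita I M Z x (X x))]
  linarith

/-- Tensoriality in `X` and `Y` follows from the Leibniz rules; in `W` it follows from
skew-adjointness, see `IsOrthonormalFrameOn.curvature_apply`. -/
theorem tensorialAt_curvatureField_left (he : IsOrthonormalFrameOn e U) (hU : IsOpen U)
    {Y W : ∀ x : M, TangentSpace I x} (hW : CMDiff[U] ∞ (T% W)) (hx : x ∈ U) :
    TensorialAt I E (fun X => curvatureField X Y W x) x where
  smul {f X} hf hX := by
    have : CompleteSpace E := FiniteDimensional.complete ℝ E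
    have h1 : (fun y => leviCivita I M W y ((f • X) y)) =
        f • fun y => leviCivita I M W y (X y) := by
      ext1 y; simp
    simp only [curvatureField]
    rw [h1, leviCivita_smul hf (he.mdiffAt_leviCivita hU hW hx hX),
      VectorField.mlieBracket_smul_left hf hX]
    simp
    module
  add {X X'} hX hX' := by
    have : CompleteSpace E := FiniteDimensional.complete ℝ E
    have h1 : (fun y => leviCivita I M W y ((X + X') y)) =
        (fun y => leviCivita I M W y (X y)) + fun y => leviCivita I M W y (X' y) := by
      ext1 y; simp
    simp only [curvatureField]
    rw [h1, leviCivita_add (he.mdiffAt_leviCivita hU hW hx hX)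
      (he.mdiffAt_leviCivita hU hW hx hX'), VectorField.mlieBracket_add_left hX hX']
    simp
    abel

theorem tensorialAt_curvatureField_right (he : IsOrthonormalFrameOn e U) (hU : IsOpen U)
    {X W : ∀ x : M, TangentSpace I x} (hW : CMDiff[U] ∞ (T% W)) (hx : x ∈ U) :
    TensorialAt I E (fun Y => curvatureField X Y W x) x where
  smul {f Y} hf hY := by
    rw [curvatureField_swap, (he.tensorialAt_curvatureField_left hU hW hx).smul hf hY,
      curvatureField_swap X Y, smul_neg]
  add {Y Y'} hY hY' := by
    rw [curvatureField_swap, (he.tensorialAt_curvatureField_left hU hW hx).add hY hY',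
      curvatureField_swap X Y, curvatureField_swap X Y', neg_add]

/-- The frame can be restricted to a smaller set. -/
theorem mono (he : IsOrthonormalFrameOn e U) {V : Set M} (hVU : V ⊆ U) :
    IsOrthonormalFrameOn e V :=
  ⟨fun a => (he.contMDiffOn a).mono hVU, fun x hx => he.orthonormal x (hVU hx),
    fun x hx => he.span x (hVU hx)⟩

/-- Skew-adjointness of `curvature`, which is defined through extensions of the vectors; the
extensions are smooth only near `x`, so the frame is restricted. -/
theorem inner_curvature_skew (he : IsOrthonormalFrameOn e U) (hU : IsOpen U) (hx : x ∈ U)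
    (u v w z : TangentSpace I x) :
    inner ℝ (curvature x u v w) z = - inner ℝ w (curvature x u v z) := by
  obtain ⟨V₁, h₁, hV₁, hx₁, hu⟩ := exists_isOpen_contMDiffOn_extend hU hx u
  obtain ⟨V₂, h₂, hV₂, hx₂, hv⟩ := exists_isOpen_contMDiffOn_extend hV₁ hx₁ v
  obtain ⟨V₃, h₃, hV₃, hx₃, hw⟩ := exists_isOpen_contMDiffOn_extend hV₂ hx₂ w
  obtain ⟨V₄, h₄, hV₄, hx₄, hz⟩ := exists_isOpen_contMDiffOn_extend hV₃ hx₃ z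
  have h := (he.mono (h₄.trans (h₃.trans (h₂.trans h₁)))).inner_curvatureField_skew hV₄
    (hu.mono (h₄.trans (h₃.trans h₂))) (hv.mono (h₄.trans h₃)) (hw.mono h₄) hz hx₄
  simpa [curvature_eq_curvatureField] using h

/-- The curvature of smooth fields depends on their values only. -/
theorem curvature_apply (he : IsOrthonormalFrameOn e U) (hU : IsOpen U)
    {X Y W : ∀ x : M, TangentSpace I x} (hX : CMDiff[U] ∞ (T% X)) (hY : CMDiff[U] ∞ (T% Y))
    (hW : CMDiff[U] ∞ (T% W)) (hx : x ∈ U) :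
    curvature x (X x) (Y x) (W x) = curvatureField X Y W x := by
  have h1 : ∀ W : ∀ x : M, TangentSpace I x, ∀ V ⊆ U, IsOpen V → x ∈ V → CMDiff[V] ∞ (T% W) →
      curvatureField (FiberBundle.extend E (X x)) (FiberBundle.extend E (Y x)) W x =
        curvatureField X Y W x := by
    intro W V hVU hV hxV hW
    exact TensorialAt.pointwise₂ (I := I) (F := E) (F' := E)
      (Φ := fun X Y => curvatureField X Y W x)
      (fun _ _ => (he.mono hVU).tensorialAt_curvatureField_left hV hW hxV)
      (fun _ _ => (he.mono hVU).tensorialAt_curvatureField_right hV hW hxV)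
      (FiberBundle.mdifferentiableAt_extend ..) (hX.mdiffAt_of_isOpen hU hx)
      (FiberBundle.mdifferentiableAt_extend ..) (hY.mdiffAt_of_isOpen hU hx) (by simp) (by simp)
  refine ext_inner_right ℝ fun z => ?_
  obtain ⟨V, hVU, hV, hxV, hz⟩ := exists_isOpen_contMDiffOn_extend hU hx z
  rw [he.inner_curvature_skew hU hx, curvature_eq_curvatureField,
    h1 _ V hVU hV hxV hz]
  have := (he.mono hVU).inner_curvatureField_skew hV (hX.mono hVU) (hY.mono hVU) (hW.mono hVU)
    hz hxV
  simpa using this.symm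

/-- The curvature as a bilinear map of its first two arguments. -/
def curvatureBilin (he : IsOrthonormalFrameOn e U) (hU : IsOpen U) (hx : x ∈ U)
    (w : TangentSpace I x) :
    TangentSpace I x →L[ℝ] TangentSpace I x →L[ℝ] TangentSpace I x :=
  let V := exists_isOpen_contMDiffOn_extend hU hx w
  TensorialAt.mkHom₂ (fun X Y => curvatureField X Y (FiberBundle.extend E w) x) x
      (fun _ _ => (he.mono V.choose_spec.1).tensorialAt_curvatureField_left V.choose_spec.2.1
        V.choose_spec.2.2.2 V.choose_spec.2.2.1)
      (fun _ _ => (he.mono V.choose_spec.1).tensorialAt_curvatureField_right V.choose_spec.2.1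
        V.choose_spec.2.2.2 V.choose_spec.2.2.1)

theorem curvatureBilin_apply (he : IsOrthonormalFrameOn e U) (hU : IsOpen U) (hx : x ∈ U)
    (u v w : TangentSpace I x) : he.curvatureBilin hU hx w u v = curvature x u v w := by
  rw [curvatureBilin, TensorialAt.mkHom₂_apply_eq_extend, curvature_eq_curvatureField]

theorem curvature_add_right (he : IsOrthonormalFrameOn e U) (hU : IsOpen U) (hx : x ∈ U)
    (u v w w' : TangentSpace I x) :
    curvature x u v (w + w') = curvature x u v w + curvature x u v w' := by
  refine ext_inner_right ℝ fun z => ?_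
  simp only [inner_add_left, he.inner_curvature_skew hU hx u v _ z]
  ring

theorem curvature_smul_right (he : IsOrthonormalFrameOn e U) (hU : IsOpen U) (hx : x ∈ U)
    (c : ℝ) (u v w : TangentSpace I x) :
    curvature x u v (c • w) = c • curvature x u v w := by
  refine ext_inner_right ℝ fun z => ?_
  simp only [real_inner_smul_left, he.inner_curvature_skew hU hx u v _ z]
  ring

end IsOrthonormalFrameOn

end Frame

/-! ### Traces and the algebra of the connection coefficients -/

section Algebra

/-- The trace of a bilinear map with respect to the inner product does not depend on the
orthonormal basis. -/
theorem OrthonormalBasis.sum_apply_self_eq {V W ι ι' : Type*} [NormedAddCommGroup V]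
    [InnerProductSpace ℝ V] [AddCommGroup W] [Module ℝ W] [Fintype ι] [Fintype ι']
    (f : OrthonormalBasis ι ℝ V) (g : OrthonormalBasis ι' ℝ V) (B : V →ₗ[ℝ] V →ₗ[ℝ] W) :
    ∑ i, B (f i) (f i) = ∑ j, B (g j) (g j) := by
  classical
  have h : ∀ i, B (f i) (f i) =
      ∑ j, ∑ k, ((inner ℝ (g j) (f i) : ℝ) * inner ℝ (f i) (g k)) • B (g j) (g k) := by
    intro i
    conv_lhs => rw [← g.sum_repr' (f i)]
    simp only [map_sum, map_smul, LinearMap.sum_apply, LinearMap.smul_apply, Finset.smul_sum,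
      smul_smul]
    rw [Finset.sum_comm]
    refine Finset.sum_congr rfl fun j _ => Finset.sum_congr rfl fun k _ => ?_
    rw [real_inner_comm (g k), mul_comm]
  simp only [h]
  rw [Finset.sum_comm]
  refine Finset.sum_congr rfl fun j _ => ?_
  rw [Finset.sum_comm]
  simp only [← Finset.sum_smul, f.sum_inner_mul_inner, g.inner_eq_ite, ite_smul, one_smul,
    zero_smul, Finset.sum_ite_eq, Finset.mem_univ, if_true]

theorem OrthonormalBasis.sum_norm_sq_apply_eq {V W ι ι' : Type*} [NormedAddCommGroup V]
    [InnerProductSpace ℝ V] [NormedAddCommGroup W] [InnerProductSpace ℝ W] [Fintype ι] [Fintype ι']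
    (f : OrthonormalBasis ι ℝ V) (g : OrthonormalBasis ι' ℝ V) (B : V →ₗ[ℝ] V →ₗ[ℝ] W) :
    ∑ i, ∑ j, ‖B (f i) (f j)‖ ^ 2 = ∑ i, ∑ j, ‖B (g i) (g j)‖ ^ 2 := by
  have h : ∀ L : V →ₗ[ℝ] W, ∑ i, ‖L (f i)‖ ^ 2 = ∑ i, ‖L (g i)‖ ^ 2 := by
    intro L
    simpa [real_inner_self_eq_norm_sq] using f.sum_apply_self_eq g ((innerₗ W).compl₁₂ L L)
  rw [Finset.sum_congr rfl fun i _ => h (B (f i)), Finset.sum_comm,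
    Finset.sum_comm (f := fun i j => ‖B (g i) (g j)‖ ^ 2)]
  exact Finset.sum_congr rfl fun j _ => h (B.flip (g j))

theorem sum_antisymm_mul_symm {ι : Type*} [Fintype ι] (S T : ι → ι → ℝ)
    (hS : ∀ i j, S i j = - S j i) (hT : ∀ i j, T i j = T j i) :
    ∑ i, ∑ j, S i j * T i j = 0 := by
  have h : ∑ i, ∑ j, S i j * T i j = - ∑ i, ∑ j, S i j * T i j := by
    conv_lhs => rw [Finset.sum_comm]
    simp only [← Finset.sum_neg_distrib]
    refine Finset.sum_congr rfl fun i _ => Finset.sum_congr rfl fun j _ => ?_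
    rw [hS j i, hT j i]; ring
  linarith

variable {ι κ : Type*} [Fintype ι] [Fintype κ]

open Sum in
/-- The terms of the mixed scalar curvature that are quadratic in the connection coefficients `G`
of an adapted frame. Products of an expression that is skew in two indices with one that is
symmetric in them sum to zero; what is left are the norms of the second fundamental forms and the
products of traces. -/
theorem sum_connection_products (G : ι ⊕ κ → ι ⊕ κ → ι ⊕ κ → ℝ)
    (hG : ∀ a b c, G a b c = - G a c b)
    (h₁ : ∀ i j α, G (inl i) (inl j) (inr α) = G (inl j) (inl i) (inr α))
    (h₂ : ∀ α β i, G (inr α) (inr β) (inl i) = G (inr β) (inr α) (inl i)) :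
    ∑ i, ∑ α, (-(∑ c, G (inl i) (inl i) c * G (inr α) (inr α) c)
        + ∑ c, G (inr α) (inl i) c * G (inl i) (inr α) c
        - ∑ c, (G (inr α) (inl i) c - G (inl i) (inr α) c) * G c (inl i) (inr α))
      + ∑ i, ∑ j, ∑ α, G (inl i) (inl j) (inr α) ^ 2
      + ∑ α, ∑ β, ∑ i, G (inr α) (inr β) (inl i) ^ 2
      - ∑ α, (∑ i, G (inl i) (inl i) (inr α)) ^ 2
      - ∑ i, (∑ α, G (inr α) (inr α) (inl i)) ^ 2 =
    ∑ i, (∑ α, G (inr α) (inr α) (inl i)) * ∑ a, G a (inl i) a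
      + ∑ α, (∑ i, G (inl i) (inl i) (inr α)) * ∑ a, G a (inr α) a := by
  -- The product of the traces, split according to the type of the summation index `c`.
  have hT : ∑ i, ∑ α, ∑ c, G (inl i) (inl i) c * G (inr α) (inr α) c =
      ∑ j, (∑ i, G (inl i) (inl i) (inl j)) * (∑ α, G (inr α) (inr α) (inl j))
      + ∑ β, (∑ i, G (inl i) (inl i) (inr β)) * (∑ α, G (inr α) (inr α) (inr β)) := by
    simp only [Fintype.sum_sum_type, Finset.sum_add_distrib, Finset.sum_mul_sum]
    congr 1
    · rw [Finset.sum_congr rfl fun i _ => Finset.sum_comm, Finset.sum_comm]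
    · rw [Finset.sum_congr rfl fun i _ => Finset.sum_comm, Finset.sum_comm]
  have hR₁ : ∀ j, ∑ a, G a (inl j) a =
      -(∑ i, G (inl i) (inl i) (inl j)) - ∑ α, G (inr α) (inr α) (inl j) := by
    intro j
    rw [Fintype.sum_sum_type, Finset.sum_congr rfl fun i _ => hG (inl i) (inl j) (inl i),
      Finset.sum_congr rfl fun α _ => hG (inr α) (inl j) (inr α)]
    simp only [Finset.sum_neg_distrib]; ring
  have hR₂ : ∀ β, ∑ a, G a (inr β) a =
      -(∑ i, G (inl i) (inl i) (inr β)) - ∑ α, G (inr α) (inr α) (inr β) := by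
    intro j
    rw [Fintype.sum_sum_type, Finset.sum_congr rfl fun i _ => hG (inl i) (inr j) (inl i),
      Finset.sum_congr rfl fun α _ => hG (inr α) (inr j) (inr α)]
    simp only [Finset.sum_neg_distrib]; ring
  -- Terms with two indices in `ι`: `G (inr α) (inl i) (inl j)` is skew in `i`, `j`, whereas
  -- `G (inl i) (inl j) (inr α)` is symmetric.
  have hM₁ : ∑ i, ∑ α, ∑ j, (G (inr α) (inl i) (inl j) * G (inl i) (inr α) (inl j)
      - (G (inr α) (inl i) (inl j) - G (inl i) (inr α) (inl j)) * G (inl j) (inl i) (inr α)) =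
      - ∑ i, ∑ j, ∑ α, G (inl i) (inl j) (inr α) ^ 2 := by
    have h0 : ∑ α, ∑ i, ∑ j,
        G (inr α) (inl i) (inl j) * G (inl i) (inl j) (inr α) = 0 :=
      Finset.sum_eq_zero fun α _ => sum_antisymm_mul_symm
        (fun i j => G (inr α) (inl i) (inl j)) (fun i j => G (inl i) (inl j) (inr α))
        (fun i j => hG _ _ _) (fun i j => h₁ _ _ _)
    rw [Finset.sum_comm] at h0
    rw [Finset.sum_congr rfl fun i _ => Finset.sum_congr rfl fun α _ =>
      Finset.sum_congr rfl fun j _ => show _ = (-2) * (G (inr α) (inl i) (inl j) *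
        G (inl i) (inl j) (inr α)) - G (inl i) (inl j) (inr α) ^ 2 by
        rw [hG (inl i) (inr α) (inl j), h₁ j i]; ring]
    simp only [Finset.sum_sub_distrib, ← Finset.mul_sum, h0]
    rw [Finset.sum_congr rfl fun i _ => Finset.sum_comm]
    ring
  -- The same with the roles of `ι` and `κ` exchanged.
  have hM₂ : ∑ i, ∑ α, ∑ β, (G (inr α) (inl i) (inr β) * G (inl i) (inr α) (inr β)
      - (G (inr α) (inl i) (inr β) - G (inl i) (inr α) (inr β)) * G (inr β) (inl i) (inr α)) =
      - ∑ α, ∑ β, ∑ i, G (inr α) (inr β) (inl i) ^ 2 := by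
    have h0 : ∑ i, ∑ α, ∑ β,
        G (inl i) (inr α) (inr β) * G (inr α) (inr β) (inl i) = 0 :=
      Finset.sum_eq_zero fun i _ => sum_antisymm_mul_symm
        (fun α β => G (inl i) (inr α) (inr β)) (fun α β => G (inr α) (inr β) (inl i))
        (fun i j => hG _ _ _) (fun i j => h₂ _ _ _)
    rw [Finset.sum_congr rfl fun i _ => Finset.sum_congr rfl fun α _ =>
      Finset.sum_congr rfl fun β _ => show _ = (-2) * (G (inl i) (inr α) (inr β) *
        G (inr α) (inr β) (inl i)) - G (inr α) (inr β) (inl i) ^ 2 by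
        rw [hG (inr α) (inl i) (inr β), hG (inr β) (inl i) (inr α), h₂ β α]; ring]
    simp only [Finset.sum_sub_distrib, ← Finset.mul_sum, h0]
    rw [Finset.sum_comm, Finset.sum_congr rfl fun α _ => Finset.sum_comm]
    ring
  simp only [hR₁, hR₂]
  have hL : ∑ i, ∑ α, (-(∑ c, G (inl i) (inl i) c * G (inr α) (inr α) c)
        + ∑ c, G (inr α) (inl i) c * G (inl i) (inr α) c
        - ∑ c, (G (inr α) (inl i) c - G (inl i) (inr α) c) * G c (inl i) (inr α)) =
      -(∑ i, ∑ α, ∑ c, G (inl i) (inl i) c * G (inr α) (inr α) c)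
      + (∑ i, ∑ α, ∑ j, (G (inr α) (inl i) (inl j) * G (inl i) (inr α) (inl j)
      - (G (inr α) (inl i) (inl j) - G (inl i) (inr α) (inl j)) * G (inl j) (inl i) (inr α)))
      + (∑ i, ∑ α, ∑ β, (G (inr α) (inl i) (inr β) * G (inl i) (inr α) (inr β)
      - (G (inr α) (inl i) (inr β) - G (inl i) (inr α) (inr β)) *
        G (inr β) (inl i) (inr α))) := by
    simp only [← Finset.sum_neg_distrib, ← Finset.sum_add_distrib]
    refine Finset.sum_congr rfl fun i _ => Finset.sum_congr rfl fun α _ => ?_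
    simp only [Fintype.sum_sum_type, Finset.sum_add_distrib, Finset.sum_sub_distrib,
      Finset.sum_neg_distrib]
    ring
  rw [hL, hT, hM₁, hM₂]
  simp only [mul_sub, mul_neg, Finset.sum_sub_distrib, Finset.sum_neg_distrib, sq]
  simp only [mul_comm]
  ring

end Algebra

/-! ### Adapted frames and the divergence of the mean curvature vectors -/

section Adapted

set_option linter.unusedSectionVars false

variable {E : Type*} [NormedAddCommGroup E] [NormedSpace ℝ E] [FiniteDimensional ℝ E]
  {H : Type*} [TopologicalSpace H]
  {I : ModelWithCorners ℝ E H} {M : Type*} [TopologicalSpace M] [ChartedSpace H M]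
  [RiemannianBundle (fun x : M => TangentSpace I x)] [IsManifold I ∞ M]
  [IsContMDiffRiemannianBundle I ∞ E (fun x : M => TangentSpace I x)]

/-- The divergence of a vector field: the trace of `v ↦ ∇_v Z`. -/
def divergence (Z : ∀ x : M, TangentSpace I x) (x : M) : ℝ :=
  LinearMap.trace ℝ (TangentSpace I x) (leviCivita I M Z x)

theorem divergence_congr {X Y : ∀ x : M, TangentSpace I x} {x : M}
    (hX : MDiffAt (T% X) x) (hY : MDiffAt (T% Y) x) (h : ∀ᶠ y in 𝓝 x, X y = Y y) :
    divergence X x = divergence Y x := by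
  rw [divergence, leviCivita_congr hX hY h, divergence]

namespace IsOrthonormalFrameOn

variable {τ : Type*} [Fintype τ] {e : τ → ∀ x : M, TangentSpace I x} {U : Set M} {x : M}

theorem divergence_eq_sum (he : IsOrthonormalFrameOn e U) (hx : x ∈ U)
    (Z : ∀ x : M, TangentSpace I x) :
    divergence Z x = ∑ a, inner ℝ (e a x) (leviCivita I M Z x (e a x)) := by
  rw [divergence, LinearMap.trace_eq_sum_inner _ (he.basis hx)]
  simp [basis_apply]

theorem connCoeff_eq (he : IsOrthonormalFrameOn e U) (hU : IsOpen U) (hx : x ∈ U) (a b c : τ) :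
    inner ℝ (leviCivita I M (e b) x (e a x)) (e c x) = connCoeff e a b c x :=
  inner_leviCivita (he.mdiffAt hU hx a) (he.mdiffAt hU hx b) (he.mdiffAt hU hx c)

theorem contMDiffOn_connCoeff (he : IsOrthonormalFrameOn e U) (hU : IsOpen U) (a b c : τ) :
    CMDiff[U] ∞ (connCoeff e a b c) :=
  contMDiffOn_koszul hU (he.contMDiffOn a) (he.contMDiffOn b) (he.contMDiffOn c)

open Classical in
theorem inner_eq_ite (he : IsOrthonormalFrameOn e U) (hx : x ∈ U) (a b : τ) :
    (inner ℝ (e a x) (e b x) : ℝ) = if a = b then 1 else 0 :=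
  orthonormal_iff_ite.1 (he.orthonormal x hx) a b

theorem connCoeff_skew (he : IsOrthonormalFrameOn e U) (hU : IsOpen U) (hx : x ∈ U)
    (a b c : τ) : connCoeff e a b c x = - connCoeff e a c b x := by
  classical
  have h := leviCivita_metric (he.mdiffAt hU hx a) (he.mdiffAt hU hx b) (he.mdiffAt hU hx c)
  have h2 : innerField (e b) (e c) =ᶠ[𝓝 x] fun _ => if b = c then (1 : ℝ) else 0 := by
    filter_upwards [hU.mem_nhds hx] with y hy
    exact he.inner_eq_ite hy b c
  rw [mvfderiv_congr h2, mvfderiv_const, he.connCoeff_eq hU hx, real_inner_comm _ (e b x),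
    he.connCoeff_eq hU hx] at h
  simp only [zero_apply] at h
  linarith

theorem inner_mlieBracket (he : IsOrthonormalFrameOn e U) (hU : IsOpen U) (hx : x ∈ U)
    (a b c : τ) : inner ℝ (e c x) (VectorField.mlieBracket I (e a) (e b) x) =
      connCoeff e a b c x - connCoeff e b a c x := by
  rw [← leviCivita_sub_leviCivita (he.mdiffAt hU hx a) (he.mdiffAt hU hx b), inner_sub_right,
    real_inner_comm, he.connCoeff_eq hU hx, real_inner_comm, he.connCoeff_eq hU hx]

theorem leviCivita_frame_eq_sum (he : IsOrthonormalFrameOn e U) (hU : IsOpen U) (hx : x ∈ U)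
    (a b : τ) : leviCivita I M (e b) x (e a x) = ∑ c, connCoeff e a b c x • e c x := by
  conv_lhs => rw [← he.sum_inner_smul hx (leviCivita I M (e b) x (e a x))]
  refine Finset.sum_congr rfl fun c _ => ?_
  rw [real_inner_comm, he.connCoeff_eq hU hx]

theorem inner_sum_smul_sum_smul (he : IsOrthonormalFrameOn e U) (hx : x ∈ U) (f g : τ → ℝ) :
    inner ℝ (∑ a, f a • e a x) (∑ a, g a • e a x) = ∑ a, f a * g a := by
  classical
  simp [sum_inner, inner_sum, inner_smul_left, inner_smul_right, he.inner_eq_ite hx, mul_comm]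

/-- The curvature in terms of the connection coefficients and their derivatives. -/
theorem inner_curvatureField_frame (he : IsOrthonormalFrameOn e U) (hU : IsOpen U) (hx : x ∈ U)
    (a b c d : τ) :
    inner ℝ (curvatureField (e a) (e b) (e c) x) (e d x) =
      mvfderiv I (connCoeff e b c d) x (e a x) - mvfderiv I (connCoeff e a c d) x (e b x)
      + (-(∑ m, connCoeff e b c m x * connCoeff e a d m x)
        + ∑ m, connCoeff e a c m x * connCoeff e b d m x
        - ∑ m, (connCoeff e a b m x - connCoeff e b a m x) * connCoeff e m c d x) := by
  rw [he.inner_curvatureField hU (he.contMDiffOn a) (he.contMDiffOn b) (he.contMDiffOn c)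
    (he.contMDiffOn d) hx]
  have h : inner ℝ (leviCivita I M (e c) x (VectorField.mlieBracket I (e a) (e b) x)) (e d x) =
      ∑ m, (connCoeff e a b m x - connCoeff e b a m x) * connCoeff e m c d x := by
    conv_lhs => rw [← he.sum_inner_smul hx (VectorField.mlieBracket I (e a) (e b) x)]
    rw [map_sum, sum_inner]
    refine Finset.sum_congr rfl fun m _ => ?_
    rw [map_smul, real_inner_smul_left, he.connCoeff_eq hU hx, he.inner_mlieBracket hU hx]
  rw [h]
  simp only [he.leviCivita_frame_eq_sum hU hx, he.inner_sum_smul_sum_smul hx, connCoeff]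
  ring

/-- The divergence of a linear combination of the fields of an orthonormal frame. -/
theorem divergence_sum_smul (he : IsOrthonormalFrameOn e U) (hU : IsOpen U) (hx : x ∈ U)
    {f : τ → M → ℝ} (hf : ∀ b, CMDiff[U] ∞ (f b)) :
    divergence (fun y => ∑ b, f b y • e b y) x =
      ∑ b, (mvfderiv I (f b) x (e b x) + f b x * ∑ a, connCoeff e a b a x) := by
  classical
  rw [he.divergence_eq_sum hx]
  simp only [leviCivita_sum_smul (fun b _ => (hf b).mdiffAt_of_isOpen hU hx)
    (fun b _ => he.mdiffAt hU hx b), inner_sum]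
  rw [Finset.sum_comm]
  refine Finset.sum_congr rfl fun b _ => ?_
  simp only [inner_add_right, inner_smul_right, he.inner_eq_ite hx, Finset.sum_add_distrib,
    mul_ite, mul_one, mul_zero, Finset.sum_ite_eq', Finset.mem_univ, if_true, Finset.mul_sum]
  rw [add_comm]
  congr 1
  refine Finset.sum_congr rfl fun a _ => ?_
  rw [real_inner_comm, he.connCoeff_eq hU hx]

end IsOrthonormalFrameOn

variable {ι κ : Type*} [Fintype ι] [Fintype κ]
  {D D' : ∀ x : M, Submodule ℝ (TangentSpace I x)}
  {e : ι ⊕ κ → ∀ x : M, TangentSpace I x} {U : Set M} {x : M}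

open Sum

/-- An orthonormal frame on `U` that is adapted to the distributions `D` and `D'`: the fields
`e (inl i)` span `D`, the fields `e (inr α)` span `D'`, and the brackets of the former lie in `D`,
those of the latter in `D'`. -/
structure IsAdaptedFrameOn (D D' : ∀ x : M, Submodule ℝ (TangentSpace I x))
    (e : ι ⊕ κ → ∀ x : M, TangentSpace I x) (U : Set M) : Prop extends
    IsOrthonormalFrameOn e U where
  span_left : ∀ x ∈ U, Submodule.span ℝ (Set.range fun i => e (inl i) x) = D x
  span_right : ∀ x ∈ U, Submodule.span ℝ (Set.range fun α => e (inr α) x) = D' x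
  bracket_left : ∀ x ∈ U, ∀ i j, VectorField.mlieBracket I (e (inl i)) (e (inl j)) x ∈ D x
  bracket_right : ∀ x ∈ U, ∀ α β, VectorField.mlieBracket I (e (inr α)) (e (inr β)) x ∈ D' x

namespace IsAdaptedFrameOn

theorem swap (he : IsAdaptedFrameOn D D' e U) : IsAdaptedFrameOn D' D (e ∘ Sum.swap) U where
  contMDiffOn a := he.contMDiffOn _
  orthonormal x hx := (he.orthonormal x hx).comp _ Sum.swap_leftInverse.injective
  span x hx := by
    have h := he.span x hx
    rwa [← (Equiv.sumComm κ ι).surjective.range_comp] at h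
  span_left := he.span_right
  span_right := he.span_left
  bracket_left := he.bracket_right
  bracket_right := he.bracket_left

theorem mem_left (he : IsAdaptedFrameOn D D' e U) (hx : x ∈ U) (i : ι) : e (inl i) x ∈ D x := by
  rw [← he.span_left x hx]
  exact Submodule.subset_span ⟨i, rfl⟩

/-- The orthonormal basis of `D x` given by the frame. -/
def basisLeft (he : IsAdaptedFrameOn D D' e U) (hx : x ∈ U) : OrthonormalBasis ι ℝ (D x) :=
  OrthonormalBasis.mk (v := fun i => (⟨e (inl i) x, he.mem_left hx i⟩ : D x))
    (((D x).subtypeₗᵢ.orthonormal_comp_iff).1 ((he.orthonormal x hx).comp _ inl_injective))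
    (by
      rw [top_le_iff, ← Submodule.map_injective_of_injective (D x).injective_subtype |>.eq_iff,
        Submodule.map_span, ← Set.range_comp, Submodule.map_top, Submodule.range_subtype]
      exact he.span_left x hx)

theorem basisLeft_apply (he : IsAdaptedFrameOn D D' e U) (hx : x ∈ U) (i : ι) :
    (he.basisLeft hx i : TangentSpace I x) = e (inl i) x := by
  simp [basisLeft]

theorem starProjection_apply (he : IsAdaptedFrameOn D D' e U) (hx : x ∈ U)
    (v : TangentSpace I x) :
    (D x).starProjection v = ∑ i, (inner ℝ (e (inl i) x) v : ℝ) • e (inl i) x := by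
  rw [Submodule.starProjection_apply, (he.basisLeft hx).orthogonalProjectionOnto_apply_eq_sum]
  simp [basisLeft_apply]

theorem starProjection_orthogonal_apply (he : IsAdaptedFrameOn D D' e U) (hx : x ∈ U)
    (v : TangentSpace I x) :
    (D x)ᗮ.starProjection v = ∑ α, (inner ℝ (e (inr α) x) v : ℝ) • e (inr α) x := by
  rw [Submodule.starProjection_orthogonal_val, he.starProjection_apply hx]
  rw [sub_eq_iff_eq_add']
  simpa [Fintype.sum_sum_type] using (he.sum_inner_smul hx v).symm

/-- The second fundamental form in a frame: the projection of the extension of `w` to `D` is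
`∑ ⟨e_i, w⟩ e_i`, and the terms in which the coefficients are differentiated are multiples of `e_i`,
which the projection to the complement of `D` kills. -/
theorem secondFundamentalForm_eq_sum (he : IsAdaptedFrameOn D D' e U) (hU : IsOpen U)
    (hx : x ∈ U) (v w : D x) :
    secondFundamentalForm D x v w = ∑ i, ∑ α, ((inner ℝ (e (inl i) x) (w : TangentSpace I x) : ℝ) *
      inner ℝ (e (inr α) x) (leviCivita I M (e (inl i)) x v)) • e (inr α) x := by
  classical
  set W : ∀ y : M, TangentSpace I y := FiberBundle.extend E (w : TangentSpace I x) with hW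
  have hWx : MDiffAt (T% W) x := FiberBundle.mdifferentiableAt_extend ..
  have hf : ∀ i, MDiffAt (innerField (e (inl i)) W) x := fun i =>
    mdiffAt_innerField (he.mdiffAt hU hx _) hWx
  have h : ∀ᶠ y in 𝓝 x, (D y).starProjection (W y) =
      ∑ i, innerField (e (inl i)) W y • e (inl i) y := by
    filter_upwards [hU.mem_nhds hx] with y hy
    exact he.starProjection_apply hy _
  have hs : MDiffAt (T% (fun y => ∑ i, innerField (e (inl i)) W y • e (inl i) y)) x :=
    .sum_section fun i _ => (hf i).smul_section (he.mdiffAt hU hx _)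
  have hs' : MDiffAt (T% (fun y => (D y).starProjection (W y))) x := by
    refine hs.congr_of_eventuallyEq ?_
    filter_upwards [h] with y hy
    rw [hy]
  rw [secondFundamentalForm, ← hW, leviCivita_congr hs' hs h,
    leviCivita_sum_smul (fun i _ => hf i) (fun i _ => he.mdiffAt hU hx _), map_sum]
  refine Finset.sum_congr rfl fun i _ => ?_
  rw [he.starProjection_orthogonal_apply hx]
  refine Finset.sum_congr rfl fun α _ => ?_
  rw [inner_add_right, inner_smul_right, inner_smul_right, he.inner_eq_ite hx]
  simp [innerField, hW]

/-- The second fundamental form of `D` as a bilinear map. -/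
def secondFundamentalBilin (he : IsAdaptedFrameOn D D' e U) (hU : IsOpen U) (hx : x ∈ U) :
    D x →ₗ[ℝ] D x →ₗ[ℝ] TangentSpace I x :=
  LinearMap.mk₂ ℝ (secondFundamentalForm D x)
    (fun v v' w => by
      simp only [he.secondFundamentalForm_eq_sum hU hx, ← Finset.sum_add_distrib, ← add_smul,
        Submodule.coe_add, map_add, inner_add_right, mul_add])
    (fun c v w => by
      simp only [he.secondFundamentalForm_eq_sum hU hx, Finset.smul_sum, smul_smul,
        Submodule.coe_smul, map_smul, inner_smul_right, mul_left_comm])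
    (fun v w w' => by
      simp only [he.secondFundamentalForm_eq_sum hU hx, ← Finset.sum_add_distrib, ← add_smul,
        Submodule.coe_add, inner_add_right, add_mul])
    (fun c v w => by
      simp only [he.secondFundamentalForm_eq_sum hU hx, Finset.smul_sum, smul_smul,
        Submodule.coe_smul, inner_smul_right, mul_assoc])

theorem secondFundamentalBilin_basisLeft (he : IsAdaptedFrameOn D D' e U) (hU : IsOpen U)
    (hx : x ∈ U) (i j : ι) :
    he.secondFundamentalBilin hU hx (he.basisLeft hx i) (he.basisLeft hx j) =
      ∑ α, connCoeff e (inl i) (inl j) (inr α) x • e (inr α) x := by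
  classical
  rw [secondFundamentalBilin, LinearMap.mk₂_apply, he.secondFundamentalForm_eq_sum hU hx,
    Finset.sum_comm]
  refine Finset.sum_congr rfl fun α _ => ?_
  simp only [basisLeft_apply, he.inner_eq_ite hx, inl.injEq, ite_mul, one_mul, zero_mul, ite_smul,
    zero_smul, Finset.sum_ite_eq', Finset.mem_univ, if_true]
  rw [real_inner_comm, he.connCoeff_eq hU hx]

theorem norm_sum_smul_sq (he : IsAdaptedFrameOn D D' e U) (hx : x ∈ U) (f : κ → ℝ) :
    ‖∑ α, f α • e (inr α) x‖ ^ 2 = ∑ α, f α ^ 2 := by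
  have h := he.inner_sum_smul_sum_smul hx (Sum.elim 0 f) (Sum.elim 0 f)
  simpa [Fintype.sum_sum_type, ← real_inner_self_eq_norm_sq, sq] using h

theorem meanCurvatureVector_eq (he : IsAdaptedFrameOn D D' e U) (hU : IsOpen U) (hx : x ∈ U) :
    meanCurvatureVector D x =
      ∑ α, (∑ i, connCoeff e (inl i) (inl i) (inr α) x) • e (inr α) x := by
  have h := (stdOrthonormalBasis ℝ (D x)).sum_apply_self_eq (he.basisLeft hx)
    (he.secondFundamentalBilin hU hx)
  simp only [he.secondFundamentalBilin_basisLeft hU hx] at h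
  rw [Finset.sum_comm] at h
  simp only [Finset.sum_smul]
  exact h

theorem normSqSecondFundamentalForm_eq (he : IsAdaptedFrameOn D D' e U) (hU : IsOpen U)
    (hx : x ∈ U) :
    normSqSecondFundamentalForm D x =
      ∑ i, ∑ j, ∑ α, connCoeff e (inl i) (inl j) (inr α) x ^ 2 := by
  have h := (stdOrthonormalBasis ℝ (D x)).sum_norm_sq_apply_eq (he.basisLeft hx)
    (he.secondFundamentalBilin hU hx)
  simp only [he.secondFundamentalBilin_basisLeft hU hx, he.norm_sum_smul_sq hx] at h
  exact h

theorem mixedScalarCurvature_eq (he : IsAdaptedFrameOn D D' e U) (hU : IsOpen U)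
    (hx : x ∈ U) :
    mixedScalarCurvature D D' x = ∑ i, ∑ α,
      inner ℝ (curvatureField (e (inr α)) (e (inl i)) (e (inl i)) x) (e (inr α) x) := by
  have h₁ : ∀ u : TangentSpace I x, ∑ i, inner ℝ (curvature x u (stdOrthonormalBasis ℝ (D x) i)
      (stdOrthonormalBasis ℝ (D x) i)) u =
      ∑ i, inner ℝ (curvature x u (e (inl i) x) (e (inl i) x)) u := by
    intro u
    have h := (stdOrthonormalBasis ℝ (D x)).sum_apply_self_eq (he.basisLeft hx)
      (LinearMap.mk₂ ℝ (fun v w : D x => (inner ℝ (curvature x u v w) u : ℝ))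
      (fun v v' w => by
        simp only [← he.curvatureBilin_apply hU hx, Submodule.coe_add, map_add, inner_add_left])
      (fun c v w => by
        simp only [← he.curvatureBilin_apply hU hx, Submodule.coe_smul, map_smul,
          real_inner_smul_left, smul_eq_mul])
      (fun v w w' => by
        simp only [Submodule.coe_add, he.curvature_add_right hU hx, inner_add_left])
      (fun c v w => by
        simp only [Submodule.coe_smul, he.curvature_smul_right hU hx, real_inner_smul_left,
          smul_eq_mul]))
    simpa [he.basisLeft_apply] using h
  have h₂ : ∀ v : TangentSpace I x, ∑ α, inner ℝ (curvature x
      (stdOrthonormalBasis ℝ (D' x) α : TangentSpace I x) v v)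
      (stdOrthonormalBasis ℝ (D' x) α : TangentSpace I x) =
      ∑ α, inner ℝ (curvature x (e (inr α) x) v v) (e (inr α) x) := by
    intro v
    have h := (stdOrthonormalBasis ℝ (D' x)).sum_apply_self_eq (he.swap.basisLeft hx)
      (LinearMap.mk₂ ℝ (fun u z : D' x =>
        (inner ℝ (curvature x (u : TangentSpace I x) v v) (z : TangentSpace I x) : ℝ))
      (fun u u' z => by
        simp only [← he.curvatureBilin_apply hU hx, Submodule.coe_add, map_add, inner_add_left,
          add_apply])
      (fun c u z => by
        simp only [← he.curvatureBilin_apply hU hx, Submodule.coe_smul, map_smul,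
          real_inner_smul_left, smul_eq_mul, smul_apply])
      (fun u z z' => by simp only [Submodule.coe_add, inner_add_right])
      (fun c u z => by simp only [Submodule.coe_smul, real_inner_smul_right, smul_eq_mul]))
    simpa [he.swap.basisLeft_apply] using h
  rw [mixedScalarCurvature, Finset.sum_comm, Finset.sum_congr rfl fun α _ => h₁ _, Finset.sum_comm,
    Finset.sum_congr rfl fun i _ => h₂ _]
  refine Finset.sum_congr rfl fun i _ => Finset.sum_congr rfl fun α _ => ?_
  rw [he.curvature_apply hU (he.contMDiffOn _) (he.contMDiffOn _) (he.contMDiffOn _) hx]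

/-- Integrability of `D` makes its second fundamental form symmetric. -/
theorem connCoeff_symm_left (he : IsAdaptedFrameOn D D' e U) (hU : IsOpen U) (hx : x ∈ U)
    (i j : ι) (α : κ) : connCoeff e (inl i) (inl j) (inr α) x =
      connCoeff e (inl j) (inl i) (inr α) x := by
  classical
  rw [← sub_eq_zero, ← he.inner_mlieBracket hU hx]
  have h := he.bracket_left x hx i j
  rw [← Submodule.starProjection_eq_self_iff, he.starProjection_apply hx] at h
  rw [← h, inner_sum]
  simp [inner_smul_right, he.inner_eq_ite hx]

theorem connCoeff_symm_right (he : IsAdaptedFrameOn D D' e U) (hU : IsOpen U) (hx : x ∈ U)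
    (α β : κ) (i : ι) : connCoeff e (inr α) (inr β) (inl i) x =
      connCoeff e (inr β) (inr α) (inl i) x :=
  he.swap.connCoeff_symm_left hU hx α β i

/-- The sum of the two mean curvature vectors in an adapted frame. -/
theorem meanCurvatureVector_add_eq (he : IsAdaptedFrameOn D D' e U) (hU : IsOpen U) (hx : x ∈ U) :
    meanCurvatureVector D x + meanCurvatureVector D' x =
      ∑ b, Sum.elim (fun i y => ∑ α, connCoeff e (inr α) (inr α) (inl i) y)
        (fun α y => ∑ i, connCoeff e (inl i) (inl i) (inr α) y) b x • e b x := by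
  rw [he.meanCurvatureVector_eq hU hx, he.swap.meanCurvatureVector_eq hU hx,
    Fintype.sum_sum_type, add_comm]
  rfl

theorem contMDiffOn_meanCurvatureVector_add (he : IsAdaptedFrameOn D D' e U) (hU : IsOpen U) :
    CMDiff[U] ∞ (T% (fun y => meanCurvatureVector D y + meanCurvatureVector D' y)) := by
  have h : CMDiff[U] ∞ (T% (fun y =>
      ∑ b, Sum.elim (fun i y => ∑ α, connCoeff e (inr α) (inr α) (inl i) y)
        (fun α y => ∑ i, connCoeff e (inl i) (inl i) (inr α) y) b y • e b y)) := by
    refine .sum_section fun b _ => ContMDiffOn.smul_section ?_ (he.contMDiffOn b)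
    cases b <;> exact contMDiffOn_finsetSum fun _ _ => he.contMDiffOn_connCoeff hU _ _ _
  refine h.congr fun y hy => ?_
  rw [he.meanCurvatureVector_add_eq hU hy]

/-- The pointwise formula behind the integral formula: the divergence of the sum of the mean
curvature vectors of two complementary orthogonal integrable distributions. -/
theorem divergence_meanCurvatureVector_add (he : IsAdaptedFrameOn D D' e U) (hU : IsOpen U)
    (hx : x ∈ U) :
    divergence (fun y => meanCurvatureVector D y + meanCurvatureVector D' y) x =
      mixedScalarCurvature D D' x + normSqSecondFundamentalForm D x
        + normSqSecondFundamentalForm D' x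
        - ‖meanCurvatureVector D x‖ ^ 2 - ‖meanCurvatureVector D' x‖ ^ 2 := by
  set f : ι ⊕ κ → M → ℝ := Sum.elim (fun i y => ∑ α, connCoeff e (inr α) (inr α) (inl i) y)
        (fun α y => ∑ i, connCoeff e (inl i) (inl i) (inr α) y) with hf_def
  have hf : ∀ b, CMDiff[U] ∞ (f b) := by
    rintro (b | b) <;> exact contMDiffOn_finsetSum fun _ _ => he.contMDiffOn_connCoeff hU _ _ _
  have hZ : ∀ᶠ y in 𝓝 x, meanCurvatureVector D y + meanCurvatureVector D' y =
      ∑ b, f b y • e b y := by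
    filter_upwards [hU.mem_nhds hx] with y hy
    exact he.meanCurvatureVector_add_eq hU hy
  have hs : MDiffAt (T% (fun y => ∑ b, f b y • e b y)) x :=
    .sum_section fun b _ => ((hf b).mdiffAt_of_isOpen hU hx).smul_section (he.mdiffAt hU hx b)
  rw [divergence_congr ((he.contMDiffOn_meanCurvatureVector_add hU).mdiffAt_of_isOpen hU hx)
    hs hZ,
    he.divergence_sum_smul hU hx hf, he.mixedScalarCurvature_eq hU hx,
    he.normSqSecondFundamentalForm_eq hU hx, he.swap.normSqSecondFundamentalForm_eq hU hx,
    he.meanCurvatureVector_eq hU hx, he.swap.meanCurvatureVector_eq hU hx,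
    he.norm_sum_smul_sq hx, he.swap.norm_sum_smul_sq hx]
  have hd : ∀ a b c, MDiffAt (connCoeff e a b c) x := fun a b c =>
    (he.contMDiffOn_connCoeff hU a b c).mdiffAt_of_isOpen hU hx
  -- One of the two derivatives in the mixed curvature has its last two indices exchanged compared
  -- with the one in the divergence.
  have hneg : ∀ a b c, mvfderiv I (connCoeff e a b c) x =
      - mvfderiv I (connCoeff e a c b) x := by
    intro a b c
    rw [← mvfderiv_neg]
    refine mvfderiv_congr ?_
    filter_upwards [hU.mem_nhds hx] with y hy
    exact he.connCoeff_skew hU hy a b c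
  have h := sum_connection_products (fun a b c => connCoeff e a b c x)
    (fun a b c => he.connCoeff_skew hU hx a b c) (he.connCoeff_symm_left hU hx)
    (he.connCoeff_symm_right hU hx)
  have hK : ∑ i, ∑ α, inner ℝ (curvatureField (e (inr α)) (e (inl i)) (e (inl i)) x)
      (e (inr α) x) =
      ∑ i, ∑ α, (mvfderiv I (connCoeff e (inl i) (inl i) (inr α)) x (e (inr α) x)
        + mvfderiv I (connCoeff e (inr α) (inr α) (inl i)) x (e (inl i) x))
      + ∑ i, ∑ α, (-(∑ c, connCoeff e (inl i) (inl i) c x * connCoeff e (inr α) (inr α) c x)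
        + ∑ c, connCoeff e (inr α) (inl i) c x * connCoeff e (inl i) (inr α) c x
        - ∑ c, (connCoeff e (inr α) (inl i) c x - connCoeff e (inl i) (inr α) c x) *
          connCoeff e c (inl i) (inr α) x) := by
    simp only [← Finset.sum_add_distrib]
    refine Finset.sum_congr rfl fun i _ => Finset.sum_congr rfl fun α _ => ?_
    rw [he.inner_curvatureField_frame hU hx, hneg (inr α) (inl i) (inr α)]
    simp
  have hD : ∑ b, mvfderiv I (f b) x (e b x) =
      ∑ i, ∑ α, (mvfderiv I (connCoeff e (inl i) (inl i) (inr α)) x (e (inr α) x)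
        + mvfderiv I (connCoeff e (inr α) (inr α) (inl i)) x (e (inl i) x)) := by
    have h₁ : ∀ i, mvfderiv I (f (inl i)) x (e (inl i) x) =
        ∑ α, mvfderiv I (connCoeff e (inr α) (inr α) (inl i)) x (e (inl i) x) := by
      intro i
      simp only [hf_def, Sum.elim_inl]
      rw [mvfderiv_finset_sum fun _ _ => hd _ _ _, sum_apply]
    have h₂ : ∀ α, mvfderiv I (f (inr α)) x (e (inr α) x) =
        ∑ i, mvfderiv I (connCoeff e (inl i) (inl i) (inr α)) x (e (inr α) x) := by
      intro i
      simp only [hf_def, Sum.elim_inr]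
      rw [mvfderiv_finset_sum fun _ _ => hd _ _ _, sum_apply]
    rw [Fintype.sum_sum_type, Finset.sum_congr rfl fun i _ => h₁ i,
      Finset.sum_congr rfl fun α _ => h₂ α]
    simp only [Finset.sum_add_distrib]
    rw [add_comm, Finset.sum_comm]
  rw [hK, Finset.sum_add_distrib, hD, Fintype.sum_sum_type]
  simp only [hf_def, Sum.elim_inl, Sum.elim_inr, ← h]
  simp only [connCoeff, Function.comp_apply, Sum.swap_inl, Sum.swap_inr]
  ring

end IsAdaptedFrameOn

end Adapted

/-! ### Coordinate vector fields of a chart -/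

/-- The vector field `X` is smooth on the set `U`. -/
abbrev IsSmoothFieldOn {E : Type*} [NormedAddCommGroup E] [NormedSpace ℝ E]
    {H : Type*} [TopologicalSpace H] {I : ModelWithCorners ℝ E H} {M : Type*} [TopologicalSpace M]
    [ChartedSpace H M] [IsManifold I ∞ M] (X : ∀ x : M, TangentSpace I x) (U : Set M) : Prop :=
  CMDiff[U] ∞ (T% X)

section ChartField

set_option linter.unusedSectionVars false

variable {d : ℕ} {M : Type*} [TopologicalSpace M] [ChartedSpace (EuclideanSpace ℝ (Fin d)) M]
  {φ : OpenPartialHomeomorph M (EuclideanSpace ℝ (Fin d))} {y : M}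

/-- The coordinate vector field `∂_j` of the chart `φ`, as a vector field on the manifold. Only its
values on the domain of the chart matter. -/
def chartField (φ : OpenPartialHomeomorph M (EuclideanSpace ℝ (Fin d))) (j : Fin d) (y : M) :
    TangentSpace (𝓡 d) y :=
  VectorField.mpullback (𝓡 d) (𝓡 d) φ
    (fun _ => (EuclideanSpace.single j (1 : ℝ) : EuclideanSpace ℝ (Fin d))) y

variable [IsManifold (𝓡 d) ∞ M]

theorem mdifferentiable_of_mem_maximalAtlas (hφ : φ ∈ IsManifold.maximalAtlas (𝓡 d) ∞ M) :
    φ.MDifferentiable (𝓡 d) (𝓡 d) :=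
  ⟨(contMDiffOn_of_mem_maximalAtlas hφ).mdifferentiableOn (by simp),
    (contMDiffOn_symm_of_mem_maximalAtlas hφ).mdifferentiableOn (by simp)⟩

theorem isInvertible_mfderiv_of_mem_maximalAtlas (hφ : φ ∈ IsManifold.maximalAtlas (𝓡 d) ∞ M)
    (hy : y ∈ φ.source) : (mfderiv (𝓡 d) (𝓡 d) φ y).IsInvertible :=
  ⟨(mdifferentiable_of_mem_maximalAtlas hφ).mfderiv hy, rfl⟩

theorem mfderiv_chartField (hφ : φ ∈ IsManifold.maximalAtlas (𝓡 d) ∞ M) (hy : y ∈ φ.source)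
    (j : Fin d) : mfderiv (𝓡 d) (𝓡 d) φ y (chartField φ j y) =
      (EuclideanSpace.single j (1 : ℝ) : EuclideanSpace ℝ (Fin d)) :=
  (isInvertible_mfderiv_of_mem_maximalAtlas hφ hy).self_apply_inverse _

theorem contMDiffOn_chartField (hφ : φ ∈ IsManifold.maximalAtlas (𝓡 d) ∞ M) (j : Fin d) :
    IsSmoothFieldOn (chartField φ j) φ.source := by
  intro x hx
  have : IsManifold (𝓡 d) ((⊤ : ℕ∞) + 1) M := by simpa using ‹IsManifold (𝓡 d) ∞ M›
  refine ContMDiffAt.contMDiffWithinAt ?_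
  refine ContMDiffAt.mpullback_vectorField_preimage (m := ∞) (n := ∞) ?_
    ((contMDiffOn_of_mem_maximalAtlas hφ).contMDiffAt (φ.open_source.mem_nhds hx))
    (isInvertible_mfderiv_of_mem_maximalAtlas hφ hx) (by simp)
  exact contMDiffAt_vectorSpace_iff_contDiffAt.2 contDiffAt_const

theorem contMDiffOn_coord (hφ : φ ∈ IsManifold.maximalAtlas (𝓡 d) ∞ M) (i : Fin d) :
    ContMDiffOn (𝓡 d) 𝓘(ℝ, ℝ) ∞ (fun y => φ y i) φ.source := by
  have h : ContMDiff (𝓡 d) 𝓘(ℝ, ℝ) ∞ (fun u : EuclideanSpace ℝ (Fin d) => u i) :=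
    (EuclideanSpace.proj i : EuclideanSpace ℝ (Fin d) →L[ℝ] ℝ).contMDiff
  exact h.comp_contMDiffOn (contMDiffOn_of_mem_maximalAtlas hφ)

theorem mvfderiv_coord (hφ : φ ∈ IsManifold.maximalAtlas (𝓡 d) ∞ M) (hy : y ∈ φ.source)
    (i : Fin d) (v : TangentSpace (𝓡 d) y) :
    mvfderiv (𝓡 d) (fun y => φ y i) y v =
      EuclideanSpace.proj (𝕜 := ℝ) i (mfderiv (𝓡 d) (𝓡 d) φ y v) := by
  have h := mvfderiv_comp_apply (I := 𝓡 d) (I' := 𝓡 d) (f := φ)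
    (g := fun u : EuclideanSpace ℝ (Fin d) => u i) y
    (EuclideanSpace.proj i : EuclideanSpace ℝ (Fin d) →L[ℝ] ℝ).mdifferentiableAt
    ((mdifferentiable_of_mem_maximalAtlas hφ).mdifferentiableAt hy) v
  refine h.trans ?_
  simp only [mvfderiv, mfderiv_eq_fderiv]
  have := (EuclideanSpace.proj i : EuclideanSpace ℝ (Fin d) →L[ℝ] ℝ).fderiv (x := φ y)
  erw [this]
  rfl

theorem mvfderiv_coord_chartField (hφ : φ ∈ IsManifold.maximalAtlas (𝓡 d) ∞ M)
    (hy : y ∈ φ.source) (i j : Fin d) :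
    mvfderiv (𝓡 d) (fun y => φ y i) y (chartField φ j y) = if i = j then 1 else 0 := by
  rw [mvfderiv_coord hφ hy, mfderiv_chartField hφ hy]
  simp

/-- A tangent vector is determined by its coordinates in a chart. -/
theorem eq_of_mvfderiv_coord_eq (hφ : φ ∈ IsManifold.maximalAtlas (𝓡 d) ∞ M)
    (hy : y ∈ φ.source) {v w : TangentSpace (𝓡 d) y}
    (h : ∀ i, mvfderiv (𝓡 d) (fun y => φ y i) y v = mvfderiv (𝓡 d) (fun y => φ y i) y w) :
    v = w := by
  refine (mdifferentiable_of_mem_maximalAtlas hφ).mfderiv_injective hy ?_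
  refine PiLp.ext fun i => ?_
  have := h i
  rwa [mvfderiv_coord hφ hy, mvfderiv_coord hφ hy] at this

theorem sum_mvfderiv_coord_smul_chartField (hφ : φ ∈ IsManifold.maximalAtlas (𝓡 d) ∞ M)
    (hy : y ∈ φ.source) (v : TangentSpace (𝓡 d) y) :
    ∑ j, mvfderiv (𝓡 d) (fun y => φ y j) y v • chartField φ j y = v := by
  refine eq_of_mvfderiv_coord_eq hφ hy fun i => ?_
  rw [map_sum]
  simp [mvfderiv_coord_chartField hφ hy]

theorem linearIndependent_chartField (hφ : φ ∈ IsManifold.maximalAtlas (𝓡 d) ∞ M)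
    (hy : y ∈ φ.source) : LinearIndependent ℝ fun j => chartField φ j y := by
  rw [Fintype.linearIndependent_iff]
  intro c hc i
  have h := congrArg (mvfderiv (𝓡 d) (fun y => φ y i) y) hc
  rw [map_sum] at h
  simpa [mvfderiv_coord_chartField hφ hy] using h

/-- Coordinate fields commute: their bracket annihilates every coordinate function. -/
theorem mlieBracket_chartField (hφ : φ ∈ IsManifold.maximalAtlas (𝓡 d) ∞ M)
    (hy : y ∈ φ.source) (j k : Fin d) :
    VectorField.mlieBracket (𝓡 d) (chartField φ j) (chartField φ k) y = 0 := by
  refine eq_of_mvfderiv_coord_eq hφ hy fun i => ?_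
  have h : ∀ j, (fun y => mvfderiv (𝓡 d) (fun y => φ y i) y (chartField φ j y)) =ᶠ[𝓝 y]
      fun _ => if i = j then (1 : ℝ) else 0 := by
    intro j
    filter_upwards [φ.open_source.mem_nhds hy] with z hz
    exact mvfderiv_coord_chartField hφ hz i j
  rw [mvfderiv_mlieBracket φ.open_source (contMDiffOn_coord hφ i) (contMDiffOn_chartField hφ j)
    (contMDiffOn_chartField hφ k) hy, mvfderiv_congr (h j), mvfderiv_congr (h k)]
  simp only [mvfderiv_const, map_zero]
  exact sub_self _

theorem mfderiv_symm_eq (hφ : φ ∈ IsManifold.maximalAtlas (𝓡 d) ∞ M)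
    {u : EuclideanSpace ℝ (Fin d)} (hu : u ∈ φ.target) (w : EuclideanSpace ℝ (Fin d)) :
    (mfderiv (𝓡 d) (𝓡 d) φ.symm u w : TangentSpace (𝓡 d) (φ.symm u)) =
      ∑ j, w j • chartField φ j (φ.symm u) := by
  have hy := φ.map_target hu
  refine eq_of_mvfderiv_coord_eq hφ hy fun i => ?_
  rw [map_sum, mvfderiv_coord hφ hy]
  have h := congrArg (fun L => (L w : EuclideanSpace ℝ (Fin d)) i)
    ((mdifferentiable_of_mem_maximalAtlas hφ).comp_symm_deriv hu)
  refine (h : _ = _).trans ?_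
  simp [mvfderiv_coord_chartField hφ hy]
  rfl

theorem coordField_eq_chartField (hφ : φ ∈ IsManifold.maximalAtlas (𝓡 d) ∞ M)
    {u : EuclideanSpace ℝ (Fin d)} (hu : u ∈ φ.target) (j : Fin d) :
    coordField φ u j = chartField φ j (φ.symm u) := by
  rw [coordField, mfderiv_symm_eq hφ hu]
  simp

/-- The derivative of a function read in a chart. -/
theorem fderiv_comp_symm (hφ : φ ∈ IsManifold.maximalAtlas (𝓡 d) ∞ M)
    {u : EuclideanSpace ℝ (Fin d)} (hu : u ∈ φ.target) {f : M → ℝ} (hf : MDifferentiableAt (𝓡 d) 𝓘(ℝ, ℝ) f (φ.symm u))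
    (w : EuclideanSpace ℝ (Fin d)) :
    fderiv ℝ (f ∘ φ.symm) u w =
      ∑ j, w j * mvfderiv (𝓡 d) f (φ.symm u) (chartField φ j (φ.symm u)) := by
  have h := mvfderiv_comp_apply (I := 𝓡 d) (I' := 𝓡 d) (f := φ.symm) (g := f) u hf
    ((mdifferentiable_of_mem_maximalAtlas hφ).symm.mdifferentiableAt hu) w
  rw [mfderiv_symm_eq hφ hu, map_sum] at h
  simp only [mvfderiv, mfderiv_eq_fderiv] at h ⊢
  refine Eq.trans ?_ (h.trans ?_)
  · rfl
  · simp

theorem contDiffOn_comp_symm (hφ : φ ∈ IsManifold.maximalAtlas (𝓡 d) ∞ M) {f : M → ℝ}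
    {U : Set M} (hf : ContMDiffOn (𝓡 d) 𝓘(ℝ, ℝ) ∞ f U) :
    ContDiffOn ℝ ∞ (f ∘ φ.symm) (φ.target ∩ φ.symm ⁻¹' U) := by
  rw [← contMDiffOn_iff_contDiffOn]
  exact hf.comp' (contMDiffOn_symm_of_mem_maximalAtlas hφ)

end ChartField

/-! ### Adapted frames of a pair of orthogonal foliations -/

section GramSchmidt

variable {E : Type*} [NormedAddCommGroup E] [NormedSpace ℝ E]
  {H : Type*} [TopologicalSpace H]
  {I : ModelWithCorners ℝ E H} {M : Type*} [TopologicalSpace M] [ChartedSpace H M]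
  [RiemannianBundle (fun x : M => TangentSpace I x)] [IsManifold I ∞ M]
  [IsContMDiffRiemannianBundle I ∞ E (fun x : M => TangentSpace I x)]
  {k : ℕ} {X : Fin k → ∀ x : M, TangentSpace I x} {U : Set M}

/-- Gram-Schmidt preserves smoothness: each vector is a combination of the previous ones with smooth
coefficients, whose denominators do not vanish by linear independence. -/
theorem contMDiffOn_gramSchmidt (hX : ∀ i, CMDiff[U] ∞ (T% (X i)))
    (hli : ∀ y ∈ U, LinearIndependent ℝ fun i => X i y) (i : Fin k) :
    CMDiff[U] ∞ (T% (fun y => InnerProductSpace.gramSchmidt ℝ (fun i => X i y) i)) := by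
  induction i using WellFoundedLT.induction with
  | ind n ih =>
  set g : Fin k → ∀ y : M, TangentSpace I y :=
    fun i y => InnerProductSpace.gramSchmidt ℝ (fun i => X i y) i with hg
  have hc : ∀ i < n, CMDiff[U] ∞
      (fun y => innerField (g i) (X n) y / innerField (g i) (g i) y) := by
    intro i hi
    refine (contMDiffOn_innerField (ih i hi) (hX n)).div₀
      (contMDiffOn_innerField (ih i hi) (ih i hi)) fun y hy => ?_
    simpa [innerField, hg] using InnerProductSpace.gramSchmidt_ne_zero i (hli y hy)
  refine ((hX n).sub_section (.sum_section (s := Finset.Iio n) fun i hi =>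
    (hc i (Finset.mem_Iio.1 hi)).smul_section (ih i (Finset.mem_Iio.1 hi)))).congr fun y hy => ?_
  have h := InnerProductSpace.gramSchmidt_def'' ℝ (fun i => X i y) n
  rw [← sub_eq_iff_eq_add] at h
  refine congrArg (TotalSpace.mk' E y) ?_
  rw [← h]
  simp only [hg, innerField, real_inner_self_eq_norm_sq, Pi.sub_apply, Pi.smul_apply']
  rfl

theorem contMDiffOn_gramSchmidtNormed (hX : ∀ i, CMDiff[U] ∞ (T% (X i)))
    (hli : ∀ y ∈ U, LinearIndependent ℝ fun i => X i y) (i : Fin k) :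
    CMDiff[U] ∞ (T% (fun y => InnerProductSpace.gramSchmidtNormed ℝ (fun i => X i y) i)) := by
  set g : ∀ y : M, TangentSpace I y :=
    fun y => InnerProductSpace.gramSchmidt ℝ (fun i => X i y) i with hg
  have h := contMDiffOn_gramSchmidt hX hli i
  have hs : CMDiff[U] ∞ (fun y => (Real.sqrt (innerField g g y))⁻¹) := by
    intro y hy
    have h0 : innerField g g y ≠ 0 := by
      simpa [innerField, hg] using InnerProductSpace.gramSchmidt_ne_zero i (hli y hy)
    have h1 : ContDiffAt ℝ ∞ (fun t : ℝ => (Real.sqrt t)⁻¹) (innerField g g y) :=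
      (Real.contDiffAt_sqrt h0).inv (by
        rw [Real.sqrt_ne_zero']
        exact lt_of_le_of_ne real_inner_self_nonneg h0.symm)
    exact h1.contMDiffAt.comp_contMDiffWithinAt y (contMDiffOn_innerField h h y hy)
  refine (hs.smul_section h).congr fun y hy => ?_
  simp only [InnerProductSpace.gramSchmidtNormed, hg, innerField, real_inner_self_eq_norm_sq,
    Real.sqrt_sq (norm_nonneg _)]
  rfl

end GramSchmidt

section Foliation

variable {d k : ℕ} {M : Type*} [TopologicalSpace M] [ChartedSpace (EuclideanSpace ℝ (Fin d)) M]
  {φ : OpenPartialHomeomorph M (EuclideanSpace ℝ (Fin d))} {x : M} [IsManifold (𝓡 d) ∞ M]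

namespace Foliation

variable (F : Foliation d k M)

/-- A single foliated chart suffices to test tangency: on its plaques the last coordinates of any
other foliated chart are locally constant. -/
theorem mem_tangent_iff (hφ : φ ∈ F.charts) (hx : x ∈ φ.source) (v : TangentSpace (𝓡 d) x) :
    v ∈ F.tangent x ↔ ∀ i : Fin d, k ≤ i → mvfderiv (𝓡 d) (fun y => φ y i) x v = 0 := by
  refine ⟨fun hv => hv φ hφ hx, fun hv ψ hψ hxψ i hi => ?_⟩
  have hφ' := F.charts_subset hφ
  have hψ' := F.charts_subset hψ
  set f : M → ℝ := fun y => ψ y i with hf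
  have hu : φ x ∈ φ.target := φ.map_source hx
  have hux : φ.symm (φ x) = x := φ.left_inv hx
  have hfd : MDifferentiableAt (𝓡 d) 𝓘(ℝ, ℝ) f x :=
    (contMDiffOn_coord hψ' i).mdiffAt_of_isOpen ψ.open_source hxψ
  set w : EuclideanSpace ℝ (Fin d) :=
    WithLp.toLp 2 fun j => mvfderiv (𝓡 d) (fun y => φ y j) x v with hw
  have h1 := fderiv_comp_symm hφ' hu (f := f) (by rwa [hux]) w
  have h2 : mvfderiv (𝓡 d) f x v = fderiv ℝ (f ∘ φ.symm) (φ x) w := by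
    rw [h1, hux]
    conv_lhs => rw [← sum_mvfderiv_coord_smul_chartField hφ' hx v]
    rw [map_sum]
    simp [hw]
  rw [h2]
  obtain ⟨V, hV, hVc⟩ := F.compatible φ hφ ψ hψ (φ x) (by
    simpa [hu, hux] using hxψ)
  have hdiff : DifferentiableAt ℝ (f ∘ φ.symm) (φ x) := by
    have h3 := contDiffOn_comp_symm hφ' (contMDiffOn_coord hψ' i)
    refine (h3.contDiffAt ?_).differentiableAt (by simp)
    exact (φ.symm.isOpen_inter_preimage ψ.open_source).mem_nhds ⟨hu, by
      simpa [hux] using hxψ⟩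
  -- The last coordinates of `w` vanish, so the line in direction `w` stays in a plaque of `φ`.
  have h4 := hdiff.hasFDerivAt.hasLineDerivAt w
  have h5 : (fun t : ℝ => (f ∘ φ.symm) (φ x + t • w)) =ᶠ[𝓝 0] fun _ => (f ∘ φ.symm) (φ x) := by
    have hc : Filter.Tendsto (fun t : ℝ => φ x + t • w) (𝓝 0) (𝓝 (φ x)) := by
      have : Continuous fun t : ℝ => φ x + t • w := by fun_prop
      simpa using this.tendsto 0
    filter_upwards [hc hV] with t ht
    refine hVc _ ht _ (mem_of_mem_nhds hV) (fun j hj => ?_) i hi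
    simp [hw, hv j hj]
  exact h4.unique ((hasDerivAt_const (0 : ℝ) ((f ∘ φ.symm) (φ x))).congr_of_eventuallyEq h5)

theorem span_chartField (hφ : φ ∈ F.charts) (hx : x ∈ φ.source) :
    Submodule.span ℝ (Set.range fun i : Fin k => chartField φ (Fin.castLE F.le_dim i) x) =
      F.tangent x := by
  have hφ' := F.charts_subset hφ
  refine le_antisymm (Submodule.span_le.2 ?_) fun v hv => ?_
  · rintro _ ⟨j, rfl⟩
    refine (F.mem_tangent_iff hφ hx _).2 fun i hi => ?_
    rw [mvfderiv_coord_chartField hφ' hx, if_neg]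
    rintro rfl
    simp at hi
    omega
  · rw [← sum_mvfderiv_coord_smul_chartField hφ' hx v]
    refine Submodule.sum_mem _ fun j _ => ?_
    by_cases hj : k ≤ j
    · rw [hv φ hφ hx j hj, zero_smul]
      exact Submodule.zero_mem _
    · exact Submodule.smul_mem _ _ (Submodule.subset_span ⟨⟨j, not_le.1 hj⟩, rfl⟩)

variable {F} in
/-- The tangent distribution of a foliation is involutive. -/
theorem mlieBracket_mem_tangent (hφ : φ ∈ F.charts) {U : Set M} (hU : IsOpen U)
    (hUφ : U ⊆ φ.source) (hx : x ∈ U) {X Y : ∀ x : M, TangentSpace (𝓡 d) x}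
    (hX : IsSmoothFieldOn X U) (hY : IsSmoothFieldOn Y U)
    (hXF : ∀ y ∈ U, X y ∈ F.tangent y) (hYF : ∀ y ∈ U, Y y ∈ F.tangent y) :
    VectorField.mlieBracket (𝓡 d) X Y x ∈ F.tangent x := by
  refine (F.mem_tangent_iff hφ (hUφ hx) _).2 fun i hi => ?_
  have h : ∀ Z : ∀ x : M, TangentSpace (𝓡 d) x, (∀ y ∈ U, Z y ∈ F.tangent y) →
      (fun y => mvfderiv (𝓡 d) (fun y => φ y i) y (Z y)) =ᶠ[𝓝 x] fun _ => (0 : ℝ) := by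
    intro Z hZ
    filter_upwards [hU.mem_nhds hx] with z hz
    exact hZ z hz φ hφ (hUφ hz) i hi
  rw [mvfderiv_mlieBracket hU ((contMDiffOn_coord (F.charts_subset hφ) i).mono hUφ) hX hY hx,
    mvfderiv_congr (h X hXF), mvfderiv_congr (h Y hYF)]
  simp only [mvfderiv_const]
  exact sub_self _

variable [RiemannianBundle (fun x : M => TangentSpace (𝓡 d) x)]
  [IsContMDiffRiemannianBundle (𝓡 d) ∞ (EuclideanSpace ℝ (Fin d))
    (fun x : M => TangentSpace (𝓡 d) x)]

theorem exists_orthonormal_span_eq_tangent (hφ : φ ∈ F.charts) :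
    ∃ e : Fin k → ∀ x : M, TangentSpace (𝓡 d) x, (∀ i, IsSmoothFieldOn (e i) φ.source) ∧
      ∀ y ∈ φ.source, (Orthonormal ℝ fun i => e i y) ∧
        Submodule.span ℝ (Set.range fun i => e i y) = F.tangent y := by
  have hφ' := F.charts_subset hφ
  have hli : ∀ y ∈ φ.source, LinearIndependent ℝ
      fun i : Fin k => chartField φ (Fin.castLE F.le_dim i) y := fun y hy =>
    (linearIndependent_chartField hφ' hy).comp _ (Fin.castLE_injective F.le_dim)
  refine ⟨fun i y => InnerProductSpace.gramSchmidtNormed ℝ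
    (fun i : Fin k => chartField φ (Fin.castLE F.le_dim i) y) i, fun i =>
    contMDiffOn_gramSchmidtNormed (fun i => contMDiffOn_chartField hφ' _) hli i,
    fun y hy => ⟨InnerProductSpace.gramSchmidtNormed_orthonormal (hli y hy), ?_⟩⟩
  rw [← F.span_chartField hφ hy]
  exact (InnerProductSpace.span_gramSchmidtNormed_range _).trans
    (InnerProductSpace.span_gramSchmidt ℝ _)

end Foliation

end Foliation

section Pair

variable {n p : ℕ} {M : Type*} [TopologicalSpace M]
    [ChartedSpace (EuclideanSpace ℝ (Fin (n + p))) M] [IsManifold (𝓡 (n + p)) ∞ M]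
    [RiemannianBundle (fun x : M => TangentSpace (𝓡 (n + p)) x)]
    [IsContMDiffRiemannianBundle (𝓡 (n + p)) ∞ (EuclideanSpace ℝ (Fin (n + p)))
      (fun x : M => TangentSpace (𝓡 (n + p)) x)]

/-- The two orthonormal frames, of `n` and `p` fields, span the tangent space because its dimension
is `n + p`. -/
theorem exists_isAdaptedFrameOn (F : Foliation (n + p) n M) (F' : Foliation (n + p) p M)
    (horth : ∀ x : M, F.tangent x ⟂ F'.tangent x) (x : M) :
    ∃ U : Set M, IsOpen U ∧ x ∈ U ∧ ∃ e : Fin n ⊕ Fin p → ∀ x : M, TangentSpace (𝓡 (n + p)) x,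
      IsAdaptedFrameOn F.tangent F'.tangent e U := by
  obtain ⟨φ, hφ, hx⟩ := F.cover x
  obtain ⟨ψ, hψ, hx'⟩ := F'.cover x
  obtain ⟨e, he, heF⟩ := F.exists_orthonormal_span_eq_tangent hφ
  obtain ⟨f, hf, hfF⟩ := F'.exists_orthonormal_span_eq_tangent hψ
  have hmem : ∀ y ∈ φ.source, ∀ i, e i y ∈ F.tangent y := fun y hy i =>
    (heF y hy).2 ▸ Submodule.subset_span ⟨i, rfl⟩
  have hmem' : ∀ y ∈ ψ.source, ∀ i, f i y ∈ F'.tangent y := fun y hy i =>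
    (hfF y hy).2 ▸ Submodule.subset_span ⟨i, rfl⟩
  have hU : IsOpen (φ.source ∩ ψ.source) := φ.open_source.inter ψ.open_source
  have hon : ∀ y ∈ φ.source ∩ ψ.source, Orthonormal ℝ fun a => Sum.elim e f a y := by
    rintro y ⟨hy, hy'⟩
    refine ⟨?_, ?_⟩
    · rintro (i | i)
      · exact (heF y hy).1.1 i
      · exact (hfF y hy').1.1 i
    · rintro (i | i) (j | j) hij
      · exact (heF y hy).1.2 (fun h => hij (h ▸ rfl))
      · exact (horth y).inner_eq (hmem y hy i) (hmem' y hy' j)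
      · exact (horth y).symm.inner_eq (hmem' y hy' i) (hmem y hy j)
      · exact (hfF y hy').1.2 (fun h => hij (h ▸ rfl))
  refine ⟨φ.source ∩ ψ.source, hU, ⟨hx, hx'⟩, Sum.elim e f,
    { contMDiffOn := ?_, orthonormal := hon, span := ?_, span_left := ?_, span_right := ?_,
      bracket_left := ?_, bracket_right := ?_ }⟩
  · rintro (i | i)
    · exact (he i).mono Set.inter_subset_left
    · exact (hf i).mono Set.inter_subset_right
  · intro y hy
    rw [(hon y hy).linearIndependent.span_eq_top_of_card_eq_finrank']
    have : Module.finrank ℝ (TangentSpace (𝓡 (n + p)) y) = n + p :=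
      finrank_euclideanSpace_fin (𝕜 := ℝ)
    simp [this]
  · exact fun y hy => (heF y hy.1).2
  · exact fun y hy => (hfF y hy.2).2
  · exact fun y hy i j => Foliation.mlieBracket_mem_tangent hφ hU Set.inter_subset_left hy
      ((he i).mono Set.inter_subset_left) ((he j).mono Set.inter_subset_left)
      (fun z hz => hmem z hz.1 i) (fun z hz => hmem z hz.1 j)
  · exact fun y hy i j => Foliation.mlieBracket_mem_tangent hψ hU Set.inter_subset_right hy
      ((hf i).mono Set.inter_subset_right) ((hf j).mono Set.inter_subset_right)
      (fun z hz => hmem' z hz.2 i) (fun z hz => hmem' z hz.2 j)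

end Pair

/-! ### The Riemannian volume in a chart -/

theorem det_of_inner_pos {V : Type*} [NormedAddCommGroup V] [InnerProductSpace ℝ V] {ι : Type*}
    [Fintype ι] [DecidableEq ι] {v : ι → V} (hv : LinearIndependent ℝ v) :
    0 < (Matrix.of fun i j => (inner ℝ (v i) (v j) : ℝ)).det :=
  (Matrix.posDef_gram_of_linearIndependent (𝕜 := ℝ) hv).det_pos

section Gram

set_option linter.unusedSectionVars false

variable {d : ℕ} {M : Type*} [TopologicalSpace M] [ChartedSpace (EuclideanSpace ℝ (Fin d)) M]
  [IsManifold (𝓡 d) ∞ M] [RiemannianBundle (fun x : M => TangentSpace (𝓡 d) x)]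
  [IsContMDiffRiemannianBundle (𝓡 d) ∞ (EuclideanSpace ℝ (Fin d))
    (fun x : M => TangentSpace (𝓡 d) x)]
  {φ ψ : OpenPartialHomeomorph M (EuclideanSpace ℝ (Fin d))} {y : M}

/-- The Gram matrix of the coordinate fields of the chart `φ`, as a function on the manifold. -/
def chartGram (φ : OpenPartialHomeomorph M (EuclideanSpace ℝ (Fin d))) (y : M) :
    Matrix (Fin d) (Fin d) ℝ :=
  Matrix.of fun i j => innerField (chartField φ i) (chartField φ j) y

/-- The density of the Riemannian volume in the chart `φ`, as a function on the manifold. -/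
def chartDensity (φ : OpenPartialHomeomorph M (EuclideanSpace ℝ (Fin d))) (y : M) : ℝ :=
  Real.sqrt (chartGram φ y).det

theorem chartGram_det_pos (hφ : φ ∈ IsManifold.maximalAtlas (𝓡 d) ∞ M) (hy : y ∈ φ.source) :
    0 < (chartGram φ y).det :=
  det_of_inner_pos (linearIndependent_chartField hφ hy)

theorem chartDensity_pos (hφ : φ ∈ IsManifold.maximalAtlas (𝓡 d) ∞ M) (hy : y ∈ φ.source) :
    0 < chartDensity φ y :=
  Real.sqrt_pos.2 (chartGram_det_pos hφ hy)

theorem contMDiffOn_chartDensity (hφ : φ ∈ IsManifold.maximalAtlas (𝓡 d) ∞ M) :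
    ContMDiffOn (𝓡 d) 𝓘(ℝ, ℝ) ∞ (chartDensity φ) φ.source := by
  have h : ContMDiffOn (𝓡 d) 𝓘(ℝ, ℝ) ∞ (fun y => (chartGram φ y).det) φ.source := by
    simp only [Matrix.det_apply']
    refine contMDiffOn_finsetSum fun σ _ => contMDiffOn_const.mul
      (contMDiffOn_finsetProd fun i _ => ?_)
    exact contMDiffOn_innerField (contMDiffOn_chartField hφ _) (contMDiffOn_chartField hφ _)
  intro y hy
  exact (Real.contDiffAt_sqrt (chartGram_det_pos hφ hy).ne').contMDiffAt.comp_contMDiffWithinAt y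
    (h y hy)

theorem metricMatrix_eq (hφ : φ ∈ IsManifold.maximalAtlas (𝓡 d) ∞ M)
    {u : EuclideanSpace ℝ (Fin d)} (hu : u ∈ φ.target) :
    metricMatrix φ u = chartGram φ (φ.symm u) := by
  ext i j
  simp [metricMatrix, chartGram, innerField, coordField_eq_chartField hφ hu]

/-- The Gram matrices of two charts differ by the Jacobian matrix of the change of coordinates. -/
theorem chartDensity_eq_abs_det_mul (hφ : φ ∈ IsManifold.maximalAtlas (𝓡 d) ∞ M)
    (hy : y ∈ φ.source) :
    chartDensity ψ y = |(Matrix.of fun i j =>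
      mvfderiv (𝓡 d) (fun y => φ y i) y (chartField ψ j y)).det| * chartDensity φ y := by
  set J : Matrix (Fin d) (Fin d) ℝ := Matrix.of fun i j =>
      mvfderiv (𝓡 d) (fun y => φ y i) y (chartField ψ j y) with hJ
  have h : chartGram ψ y = J.transpose * chartGram φ y * J := by
    ext i j
    simp only [chartGram, Matrix.of_apply, innerField, Matrix.mul_apply, Matrix.transpose_apply,
      Finset.sum_mul]
    conv_lhs => rw [← sum_mvfderiv_coord_smul_chartField hφ hy (chartField ψ i y),
      ← sum_mvfderiv_coord_smul_chartField hφ hy (chartField ψ j y)]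
    simp only [sum_inner, inner_sum, real_inner_smul_left, real_inner_smul_right]
    refine Finset.sum_congr rfl fun a _ => Finset.sum_congr rfl fun b _ => ?_
    simp only [hJ, Matrix.of_apply]
    ring
  rw [chartDensity, h, Matrix.det_mul, Matrix.det_mul, Matrix.det_transpose, chartDensity,
    show J.det * (chartGram φ y).det * J.det = J.det ^ 2 * (chartGram φ y).det by ring,
    Real.sqrt_mul (sq_nonneg _), Real.sqrt_sq_eq_abs]

theorem contDiffOn_transition (hφ : φ ∈ IsManifold.maximalAtlas (𝓡 d) ∞ M)
    (hψ : ψ ∈ IsManifold.maximalAtlas (𝓡 d) ∞ M) :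
    ContDiffOn ℝ ∞ (φ ∘ ψ.symm) (ψ.target ∩ ψ.symm ⁻¹' φ.source) := by
  rw [← contMDiffOn_iff_contDiffOn]
  exact (contMDiffOn_of_mem_maximalAtlas hφ).comp' (contMDiffOn_symm_of_mem_maximalAtlas hψ)

theorem det_fderiv_transition (hφ : φ ∈ IsManifold.maximalAtlas (𝓡 d) ∞ M)
    (hψ : ψ ∈ IsManifold.maximalAtlas (𝓡 d) ∞ M) {u : EuclideanSpace ℝ (Fin d)}
    (hu : u ∈ ψ.target) (hy : ψ.symm u ∈ φ.source) :
    (fderiv ℝ (φ ∘ ψ.symm) u).det = (Matrix.of fun i j =>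
      mvfderiv (𝓡 d) (fun y => φ y i) (ψ.symm u) (chartField ψ j (ψ.symm u))).det := by
  have hd : DifferentiableAt ℝ (φ ∘ ψ.symm) u :=
    ((contDiffOn_transition hφ hψ).contDiffAt
      ((ψ.symm.isOpen_inter_preimage φ.open_source).mem_nhds ⟨hu, hy⟩)).differentiableAt (by simp)
  rw [ContinuousLinearMap.det, ← LinearMap.det_toMatrix (EuclideanSpace.basisFun (Fin d) ℝ).toBasis]
  congr 1
  ext i j
  have h := fderiv_comp_symm hψ hu ((contMDiffOn_coord hφ i).mdiffAt_of_isOpen φ.open_source hy)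
    (EuclideanSpace.single j 1)
  have h2 := ((EuclideanSpace.proj i : EuclideanSpace ℝ (Fin d) →L[ℝ] ℝ).hasFDerivAt.comp u
    hd.hasFDerivAt).fderiv
  rw [LinearMap.toMatrix_apply]
  simp only [Matrix.of_apply]
  have h3 : (fun y => φ y i) ∘ ψ.symm =
    (EuclideanSpace.proj i : EuclideanSpace ℝ (Fin d) →L[ℝ] ℝ) ∘ (φ ∘ ψ.symm) := rfl
  rw [h3, h2] at h
  simpa using h

end Gram

section Measure

set_option linter.unusedSectionVars false

variable {d : ℕ} {M : Type*} [TopologicalSpace M] [ChartedSpace (EuclideanSpace ℝ (Fin d)) M]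
  [IsManifold (𝓡 d) ∞ M] [RiemannianBundle (fun x : M => TangentSpace (𝓡 d) x)]
  [IsContMDiffRiemannianBundle (𝓡 d) ∞ (EuclideanSpace ℝ (Fin d))
    (fun x : M => TangentSpace (𝓡 d) x)] [MeasurableSpace M] [BorelSpace M]
  {φ ψ : OpenPartialHomeomorph M (EuclideanSpace ℝ (Fin d))} {y : M} {B : Set M}

theorem OpenPartialHomeomorph.measurableSet_target_inter_preimage
    (φ : OpenPartialHomeomorph M (EuclideanSpace ℝ (Fin d))) (hB : MeasurableSet B) :
    MeasurableSet (φ.target ∩ φ.symm ⁻¹' B) := by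
  have h : Measurable (φ.target.domRestrict φ.symm) :=
    (continuousOn_iff_continuous_domRestrict.1 φ.continuousOn_symm).measurable
  have h2 := (MeasurableEmbedding.subtype_coe φ.open_target.measurableSet).measurableSet_image.2
    (h hB)
  convert h2 using 1
  ext u
  simp [Set.domRestrict_apply, and_comm]

theorem OpenPartialHomeomorph.aemeasurable_symm
    (φ : OpenPartialHomeomorph M (EuclideanSpace ℝ (Fin d))) :
    AEMeasurable φ.symm ((volume : Measure (EuclideanSpace ℝ (Fin d))).restrict φ.target) :=
  φ.continuousOn_symm.aemeasurable φ.open_target.measurableSet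

theorem chartVolume_eq_map (hφ : φ ∈ IsManifold.maximalAtlas (𝓡 d) ∞ M) :
    chartVolume φ = ((volume.restrict φ.target).withDensity
      fun u => ENNReal.ofReal (chartDensity φ (φ.symm u))).map φ.symm := by
  rw [chartVolume]
  congr 1
  refine withDensity_congr_ae ?_
  filter_upwards [ae_restrict_mem φ.open_target.measurableSet] with u hu
  rw [metricMatrix_eq hφ hu, chartDensity]

theorem chartVolume_apply (hφ : φ ∈ IsManifold.maximalAtlas (𝓡 d) ∞ M) (hB : MeasurableSet B) :
    chartVolume φ B =
      ∫⁻ u in φ.target ∩ φ.symm ⁻¹' B, ENNReal.ofReal (chartDensity φ (φ.symm u)) := by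
  rw [chartVolume_eq_map hφ, Measure.map_apply_of_aemeasurable
    (φ.aemeasurable_symm.mono_ac (withDensity_absolutelyContinuous _ _)) hB, withDensity_apply',
    Measure.restrict_restrict' φ.open_target.measurableSet, Set.inter_comm]

/-- The chart volume is concentrated on the domain of the chart. -/
theorem chartVolume_inter_source (hφ : φ ∈ IsManifold.maximalAtlas (𝓡 d) ∞ M)
    (hB : MeasurableSet B) : chartVolume φ (B ∩ φ.source) = chartVolume φ B := by
  rw [chartVolume_apply hφ hB, chartVolume_apply hφ (hB.inter φ.open_source.measurableSet)]
  congr 2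
  ext u
  simp only [Set.mem_inter_iff, Set.mem_preimage]
  exact ⟨fun h => ⟨h.1, h.2.1⟩, fun h => ⟨h.1, h.2, φ.map_target h.1⟩⟩

/-- Two charts give the same volume to a set contained in both their domains. -/
theorem chartVolume_eq_of_subset (hφ : φ ∈ IsManifold.maximalAtlas (𝓡 d) ∞ M)
    (hψ : ψ ∈ IsManifold.maximalAtlas (𝓡 d) ∞ M) (hB : MeasurableSet B)
    (hBφ : B ⊆ φ.source) (hBψ : B ⊆ ψ.source) : chartVolume ψ B = chartVolume φ B := by
  rw [chartVolume_apply hφ hB, chartVolume_apply hψ hB]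
  set S := ψ.target ∩ ψ.symm ⁻¹' B with hS
  have himage : φ.target ∩ φ.symm ⁻¹' B = (φ ∘ ψ.symm) '' S := by
    ext u
    constructor
    · rintro ⟨hu, huB⟩
      refine ⟨ψ (φ.symm u), ⟨ψ.map_source (hBψ huB), ?_⟩, ?_⟩
      · simpa [ψ.left_inv (hBψ huB)] using huB
      · simp [ψ.left_inv (hBψ huB), φ.right_inv hu]
    · rintro ⟨w, ⟨hw, hwB⟩, rfl⟩
      refine ⟨φ.map_source (hBφ hwB), ?_⟩
      simpa [φ.left_inv (hBφ hwB)] using hwB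
  have hinj : Set.InjOn (φ ∘ ψ.symm) S := by
    intro a ha b hb hab
    exact ψ.symm.injOn ha.1 hb.1 (φ.injOn (hBφ ha.2) (hBφ hb.2) hab)
  have hder : ∀ u ∈ S, HasFDerivWithinAt (φ ∘ ψ.symm) (fderiv ℝ (φ ∘ ψ.symm) u) S u := by
    intro u hu
    exact (((contDiffOn_transition hφ hψ).contDiffAt
      ((ψ.symm.isOpen_inter_preimage φ.open_source).mem_nhds
        ⟨hu.1, hBφ hu.2⟩)).differentiableAt (by simp)).hasFDerivAt.hasFDerivWithinAt
  rw [himage, lintegral_image_eq_lintegral_abs_det_fderiv_mul volume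
    (ψ.measurableSet_target_inter_preimage hB) hder hinj]
  refine setLIntegral_congr_fun (ψ.measurableSet_target_inter_preimage hB) fun u hu => ?_
  simp only [Function.comp_apply]
  rw [chartDensity_eq_abs_det_mul hφ (hBφ hu.2), φ.left_inv (hBφ hu.2),
    ENNReal.ofReal_mul (abs_nonneg _), det_fderiv_transition hφ hψ hu.1 (hBφ hu.2)]

/-- A measure that dominates all chart volumes and agrees with `chartVolume φ` on the domain of `φ`;
it bounds the supremum that defines the Riemannian volume. -/
theorem riemannianVolume_le_add (hφ : φ ∈ IsManifold.maximalAtlas (𝓡 d) ∞ M) :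
    riemannianVolume d M ≤ chartVolume φ + (riemannianVolume d M).restrict φ.sourceᶜ := by
  have hle : ∀ ψ ∈ atlas (EuclideanSpace ℝ (Fin d)) M, chartVolume ψ ≤ riemannianVolume d M :=
    fun ψ hψ => le_iSup₂ (f := fun φ (_ : φ ∈ atlas (EuclideanSpace ℝ (Fin d)) M) =>
      chartVolume φ) ψ hψ
  refine iSup₂_le fun ψ hψ => Measure.le_intro fun B hB _ => ?_
  have hψ' := IsManifold.subset_maximalAtlas (I := 𝓡 d) (n := ∞) hψ
  have hφm := φ.open_source.measurableSet
  rw [Measure.add_apply, Measure.restrict_apply hB, ← measure_inter_add_sdiff B hφm]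
  refine add_le_add ?_ (hle ψ hψ _)
  rw [← chartVolume_inter_source hψ' (hB.inter hφm),
    chartVolume_eq_of_subset hφ hψ' ((hB.inter hφm).inter ψ.open_source.measurableSet)
      (fun y hy => hy.1.2) fun y hy => hy.2]
  exact measure_mono fun y hy => hy.1.1

/-- On the domain of a chart of the atlas, the Riemannian volume is the volume of the chart. -/
theorem restrict_riemannianVolume (hφ : φ ∈ atlas (EuclideanSpace ℝ (Fin d)) M) :
    (riemannianVolume d M).restrict φ.source = chartVolume φ := by
  have hφ' := IsManifold.subset_maximalAtlas (I := 𝓡 d) (n := ∞) hφ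
  have hφm := φ.open_source.measurableSet
  ext B hB
  rw [Measure.restrict_apply hB]
  refine le_antisymm ?_ ?_
  · refine (riemannianVolume_le_add hφ' _).trans ?_
    rw [Measure.add_apply, Measure.restrict_apply (hB.inter hφm), Set.inter_assoc,
      Set.inter_compl_self, Set.inter_empty, measure_empty, add_zero]
    exact measure_mono Set.inter_subset_left
  · rw [← chartVolume_inter_source hφ' hB]
    exact le_iSup₂ (f := fun φ (_ : φ ∈ atlas (EuclideanSpace ℝ (Fin d)) M) =>
      chartVolume φ) φ hφ _

theorem setIntegral_source_riemannianVolume (hφ : φ ∈ atlas (EuclideanSpace ℝ (Fin d)) M)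
    {f : M → ℝ} (hf : ContinuousOn f φ.source) :
    ∫ y in φ.source, f y ∂(riemannianVolume d M) =
      ∫ u in φ.target, chartDensity φ (φ.symm u) * f (φ.symm u) := by
  have hφ' := IsManifold.subset_maximalAtlas (I := 𝓡 d) (n := ∞) hφ
  have hρ : ContinuousOn (fun u => chartDensity φ (φ.symm u)) φ.target :=
    (contMDiffOn_chartDensity hφ').continuousOn.comp φ.continuousOn_symm φ.symm.mapsTo
  have hm := hf.aestronglyMeasurable (μ := riemannianVolume d M)
    φ.open_source.measurableSet
  rw [restrict_riemannianVolume hφ, chartVolume_eq_map hφ'] at *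
  rw [integral_map (φ.aemeasurable_symm.mono_ac (withDensity_absolutelyContinuous _ _)) hm,
    integral_withDensity_eq_integral_toReal_smul₀
      (hρ.aemeasurable φ.open_target.measurableSet).ennreal_ofReal (by simp)]
  refine setIntegral_congr_fun φ.open_target.measurableSet fun u hu => ?_
  simp only [smul_eq_mul]
  rw [ENNReal.toReal_ofReal (chartDensity_pos hφ' (φ.map_target hu)).le]

/-- The density of a chart is continuous, hence bounded near each point. -/
theorem isLocallyFiniteMeasure_riemannianVolume : IsLocallyFiniteMeasure (riemannianVolume d M) := by
  refine ⟨fun x => ?_⟩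
  set φ := chartAt (EuclideanSpace ℝ (Fin d)) x with hφdef
  have hφ : φ ∈ atlas (EuclideanSpace ℝ (Fin d)) M := chart_mem_atlas _ x
  have hφ' := IsManifold.subset_maximalAtlas (I := 𝓡 d) (n := ∞) hφ
  have hx : x ∈ φ.source := mem_chart_source _ x
  have hρ : ContinuousOn (fun u => chartDensity φ (φ.symm u)) φ.target :=
    (contMDiffOn_chartDensity hφ').continuousOn.comp φ.continuousOn_symm φ.symm.mapsTo
  have hc := hρ.continuousAt (φ.open_target.mem_nhds (φ.map_source hx))
  obtain ⟨r, hr, hball⟩ := Metric.eventually_nhds_iff_ball.1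
    (hc.eventually_lt_const (lt_add_one _))
  set C := chartDensity φ (φ.symm (φ x)) + 1
  refine ⟨φ.source ∩ φ ⁻¹' Metric.ball (φ x) r,
    (φ.isOpen_inter_preimage Metric.isOpen_ball).mem_nhds ⟨hx, by simpa using hr⟩, ?_⟩
  have hm : MeasurableSet (φ.source ∩ φ ⁻¹' Metric.ball (φ x) r) :=
    (φ.isOpen_inter_preimage Metric.isOpen_ball).measurableSet
  rw [← Set.inter_eq_left.2 (Set.inter_subset_left (s := φ.source)), ← Measure.restrict_apply hm,
    restrict_riemannianVolume hφ, chartVolume_apply hφ' hm]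
  have hsub : φ.target ∩ φ.symm ⁻¹' (φ.source ∩ φ ⁻¹' Metric.ball (φ x) r) ⊆
      Metric.ball (φ x) r := by
    rintro u ⟨hu, -, hu'⟩
    simpa [φ.right_inv hu] using hu'
  calc _ ≤ ∫⁻ _ in φ.target ∩ φ.symm ⁻¹' (φ.source ∩ φ ⁻¹' Metric.ball (φ x) r),
        ENNReal.ofReal C := by
        refine setLIntegral_mono_ae measurable_const.aemeasurable (.of_forall fun u hu => ?_)
        exact ENNReal.ofReal_le_ofReal (hball u (hsub hu)).le
    _ ≤ ∫⁻ _ in Metric.ball (φ x) r, ENNReal.ofReal C := lintegral_mono_set hsub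
    _ < ⊤ := by
      rw [setLIntegral_const]
      exact ENNReal.mul_lt_top ENNReal.ofReal_lt_top measure_ball_lt_top

end Measure

/-! ### The divergence in a chart -/

/-- Jacobi's formula for the derivative of a determinant. -/
theorem HasDerivAt.matrix_det {n : Type*} [Fintype n] [DecidableEq n] {A : ℝ → Matrix n n ℝ}
    {A' : Matrix n n ℝ} {t : ℝ} (hA : ∀ i j, HasDerivAt (fun s => A s i j) (A' i j) t) :
    HasDerivAt (fun s => (A s).det) ((A t).adjugate * A').trace t := by
  have h : HasDerivAt (fun s => (A s).det) (∑ σ : Equiv.Perm n, ((Equiv.Perm.sign σ : ℤ) : ℝ) *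
      ∑ i, (∏ j ∈ Finset.univ.erase i, A t (σ j) j) * A' (σ i) i) t := by
    simp only [Matrix.det_apply']
    exact HasDerivAt.fun_sum fun σ _ =>
      (HasDerivAt.fun_finsetProd fun i _ => hA (σ i) i).const_mul _
  convert h using 1
  have h2 : ∀ i, ((A t).adjugate * A') i i = ((A t).updateCol i fun k => A' k i).det := by
    intro i
    rw [← Matrix.cramer_apply, Matrix.cramer_eq_adjugate_mulVec]
    rfl
  simp only [Matrix.trace, Matrix.diag, h2, Matrix.det_apply', Finset.mul_sum]
  rw [Finset.sum_comm]
  refine Finset.sum_congr rfl fun σ _ => Finset.sum_congr rfl fun i _ => ?_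
  congr 1
  rw [← Finset.prod_erase_mul _ _ (Finset.mem_univ i)]
  congr 1
  · refine Finset.prod_congr rfl fun j hj => ?_
    rw [Matrix.updateCol_ne (Finset.ne_of_mem_erase hj)]
  · simp

section Rules

variable {E : Type*} [NormedAddCommGroup E] [NormedSpace ℝ E] [FiniteDimensional ℝ E]
  {H : Type*} [TopologicalSpace H]
  {I : ModelWithCorners ℝ E H} {M : Type*} [TopologicalSpace M] [ChartedSpace H M]
  [RiemannianBundle (fun x : M => TangentSpace I x)] [IsManifold I ∞ M]
  [IsContMDiffRiemannianBundle I ∞ E (fun x : M => TangentSpace I x)] {x : M}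

theorem divergence_smul {f : M → ℝ} {X : ∀ x : M, TangentSpace I x}
    (hf : MDiffAt f x) (hX : MDiffAt (T% X) x) :
    divergence (f • X) x = f x * divergence X x + mvfderiv I f x (X x) := by
  have h : (leviCivita I M (f • X) x : TangentSpace I x →ₗ[ℝ] TangentSpace I x) =
      f x • (leviCivita I M X x : TangentSpace I x →ₗ[ℝ] TangentSpace I x) +
        LinearMap.smulRight (mvfderiv I f x : TangentSpace I x →ₗ[ℝ] ℝ) (X x) := by
    ext v
    exact leviCivita_smul hf hX v
  rw [divergence, h, map_add, map_smul, LinearMap.trace_smulRight]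
  rfl

theorem divergence_sum {ι : Type*} {s : Finset ι} {X : ι → ∀ x : M, TangentSpace I x}
    (hX : ∀ i ∈ s, MDiffAt (T% (X i)) x) :
    divergence (fun y => ∑ i ∈ s, X i y) x = ∑ i ∈ s, divergence (X i) x := by
  simp only [divergence]
  rw [leviCivita_sum hX, ← map_sum]
  congr 1
  ext v
  simp

theorem divergence_zero : divergence (fun y : M => (0 : TangentSpace I y)) x = 0 := by
  simpa using divergence_sum (x := x) (s := (∅ : Finset ℕ))
    (X := fun _ => fun y : M => (0 : TangentSpace I y)) (by simp)

end Rules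

section Chart

set_option linter.unusedSectionVars false

variable {d : ℕ} {M : Type*} [TopologicalSpace M] [ChartedSpace (EuclideanSpace ℝ (Fin d)) M]
  [IsManifold (𝓡 d) ∞ M] [RiemannianBundle (fun x : M => TangentSpace (𝓡 d) x)]
  [IsContMDiffRiemannianBundle (𝓡 d) ∞ (EuclideanSpace ℝ (Fin d))
    (fun x : M => TangentSpace (𝓡 d) x)]
  {φ : OpenPartialHomeomorph M (EuclideanSpace ℝ (Fin d))} {y : M}

theorem hasLineDerivAt_comp_symm (hφ : φ ∈ IsManifold.maximalAtlas (𝓡 d) ∞ M) (hy : y ∈ φ.source)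
    {f : M → ℝ} (hf : ContMDiffOn (𝓡 d) 𝓘(ℝ, ℝ) ∞ f φ.source) (k : Fin d) :
    HasLineDerivAt ℝ (f ∘ φ.symm) (mvfderiv (𝓡 d) f y (chartField φ k y)) (φ y)
      (EuclideanSpace.single k 1) := by
  have hu := φ.map_source hy
  have hux := φ.left_inv hy
  have hd : DifferentiableAt ℝ (f ∘ φ.symm) (φ y) :=
    ((contDiffOn_comp_symm hφ hf).contDiffAt
      ((φ.symm.isOpen_inter_preimage φ.open_source).mem_nhds
        ⟨hu, by simpa [hux] using hy⟩)).differentiableAt (by simp)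
  have h := fderiv_comp_symm hφ hu (f := f)
    (hf.mdiffAt_of_isOpen φ.open_source (by rwa [hux])) (EuclideanSpace.single k 1)
  rw [hux] at h
  have h2 := hd.hasFDerivAt.hasLineDerivAt (EuclideanSpace.single k (1 : ℝ))
  rw [h] at h2
  simpa using h2

/-- The trace in the basis of coordinate fields, whose dual basis is that of the differentials of the
coordinates. -/
theorem trace_eq_sum_chartField (hφ : φ ∈ IsManifold.maximalAtlas (𝓡 d) ∞ M)
    (hy : y ∈ φ.source) (A : TangentSpace (𝓡 d) y →L[ℝ] TangentSpace (𝓡 d) y) :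
    LinearMap.trace ℝ (TangentSpace (𝓡 d) y) A =
      ∑ i, mvfderiv (𝓡 d) (fun y => φ y i) y (A (chartField φ i y)) := by
  have h : (A : TangentSpace (𝓡 d) y →ₗ[ℝ] TangentSpace (𝓡 d) y) = ∑ i, LinearMap.smulRight
      (mvfderiv (𝓡 d) (fun y => φ y i) y : TangentSpace (𝓡 d) y →ₗ[ℝ] ℝ)
      (A (chartField φ i y)) := by
    ext v
    have := congrArg A (sum_mvfderiv_coord_smul_chartField hφ hy v)
    rw [map_sum] at this
    simpa using this.symm
  rw [h, map_sum]
  exact Finset.sum_congr rfl fun i _ => LinearMap.trace_smulRight _ _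

/-- The logarithmic derivative of the density along a coordinate field is the divergence of that
field. -/
theorem mvfderiv_chartDensity (hφ : φ ∈ IsManifold.maximalAtlas (𝓡 d) ∞ M) (hy : y ∈ φ.source)
    (k : Fin d) : mvfderiv (𝓡 d) (chartDensity φ) y (chartField φ k y) =
      chartDensity φ y * divergence (chartField φ k) y := by
  have hX : ∀ i, MDifferentiableAt (𝓡 d) ((𝓡 d).prod 𝓘(ℝ, EuclideanSpace ℝ (Fin d)))
      (T% (chartField φ i)) y := fun i =>
    (contMDiffOn_chartField hφ i).mdiffAt_of_isOpen φ.open_source hy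
  -- `C` is the matrix of `∇_{∂_k}` on coordinate fields; compatibility with the metric gives
  -- `∂_k G = C G + G Cᵀ`, and the torsion-free property `tr C = div ∂_k`.
  set C : Matrix (Fin d) (Fin d) ℝ := Matrix.of fun i j =>
    mvfderiv (𝓡 d) (fun y => φ y j) y
      (leviCivita (𝓡 d) M (chartField φ i) y (chartField φ k y)) with hC
  set G := chartGram φ y with hG
  have hCG : ∀ i j, (inner ℝ (leviCivita (𝓡 d) M (chartField φ i) y (chartField φ k y))
      (chartField φ j y) : ℝ) = (C * G) i j := by
    intro i j
    conv_lhs => rw [← sum_mvfderiv_coord_smul_chartField hφ hy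
      (leviCivita (𝓡 d) M (chartField φ i) y (chartField φ k y)), sum_inner]
    simp only [real_inner_smul_left, Matrix.mul_apply]
    rfl
  have hGsymm : G.transpose = G := by
    ext i j
    exact real_inner_comm (chartField φ i y) (chartField φ j y)
  have hder : ∀ i j, mvfderiv (𝓡 d) (innerField (chartField φ i) (chartField φ j)) y
      (chartField φ k y) = (C * G + G * C.transpose) i j := by
    intro i j
    have h : (G * C.transpose) i j = (C * G) j i := by
      rw [← Matrix.transpose_apply (C * G), Matrix.transpose_mul, hGsymm]
    rw [leviCivita_metric (hX k) (hX i) (hX j), hCG, Matrix.add_apply, h, ← hCG,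
      real_inner_comm _ (chartField φ i y), hCG j i]
  have hdiv : divergence (chartField φ k) y = C.trace := by
    rw [divergence, trace_eq_sum_chartField hφ hy]
    refine Finset.sum_congr rfl fun i _ => ?_
    have h := leviCivita_sub_leviCivita (hX i) (hX k)
    rw [mlieBracket_chartField hφ hy, sub_eq_zero] at h
    rw [h]
    rfl
  have hline : ∀ i j, HasDerivAt (fun t : ℝ =>
      chartGram φ (φ.symm (φ y + t • EuclideanSpace.single k (1 : ℝ))) i j)
      ((C * G + G * C.transpose) i j) 0 := by
    intro i j
    rw [← hder]
    exact hasLineDerivAt_comp_symm hφ hy (contMDiffOn_innerField (contMDiffOn_chartField hφ i)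
      (contMDiffOn_chartField hφ j)) k
  have h0 : chartGram φ (φ.symm (φ y + (0 : ℝ) • EuclideanSpace.single k (1 : ℝ))) = G := by
    rw [zero_smul, add_zero, φ.left_inv hy]
  have hdet := HasDerivAt.matrix_det hline
  have hpos := chartGram_det_pos hφ hy
  have hsqrt := hdet.sqrt (by rw [h0]; exact hpos.ne')
  rw [h0] at hsqrt
  have huniq := (hasLineDerivAt_comp_symm hφ hy (contMDiffOn_chartDensity hφ) k).unique hsqrt
  rw [huniq, hdiv, chartDensity, ← hG]
  have htr : (G.adjugate * (C * G + G * C.transpose)).trace = 2 * G.det * C.trace := by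
    rw [Matrix.mul_add, Matrix.trace_add, ← Matrix.mul_assoc G.adjugate G, Matrix.adjugate_mul,
      Matrix.trace_mul_comm, Matrix.mul_assoc C, Matrix.mul_adjugate]
    simp [Matrix.trace_smul]
    ring
  have hs : Real.sqrt G.det ≠ 0 := (Real.sqrt_pos.2 hpos).ne'
  rw [htr]
  field_simp
  rw [Real.sq_sqrt hpos.le]
  ring

variable {W : ∀ x : M, TangentSpace (𝓡 d) x}

theorem contMDiffOn_coord_field (hφ : φ ∈ IsManifold.maximalAtlas (𝓡 d) ∞ M)
    (hW : IsSmoothFieldOn W φ.source) (j : Fin d) :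
    ContMDiffOn (𝓡 d) 𝓘(ℝ, ℝ) ∞ (fun y => mvfderiv (𝓡 d) (fun y => φ y j) y (W y)) φ.source :=
  contMDiffOn_mvfderiv_apply φ.open_source (contMDiffOn_coord hφ j) hW

/-- The divergence in coordinates: `√g div W = ∑_j ∂_j (√g W^j)`. -/
theorem chartDensity_mul_divergence (hφ : φ ∈ IsManifold.maximalAtlas (𝓡 d) ∞ M)
    (hW : IsSmoothFieldOn W φ.source) (hy : y ∈ φ.source) :
    chartDensity φ y * divergence W y = ∑ j, mvfderiv (𝓡 d)
      (chartDensity φ * fun y => mvfderiv (𝓡 d) (fun y => φ y j) y (W y)) y (chartField φ j y) := by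
  have hX : ∀ i, MDifferentiableAt (𝓡 d) ((𝓡 d).prod 𝓘(ℝ, EuclideanSpace ℝ (Fin d)))
      (T% (chartField φ i)) y := fun i =>
    (contMDiffOn_chartField hφ i).mdiffAt_of_isOpen φ.open_source hy
  have hw : ∀ j, MDifferentiableAt (𝓡 d) 𝓘(ℝ, ℝ)
      (fun y => mvfderiv (𝓡 d) (fun y => φ y j) y (W y)) y := fun j =>
    (contMDiffOn_coord_field hφ hW j).mdiffAt_of_isOpen φ.open_source hy
  have hρ := (contMDiffOn_chartDensity hφ).mdiffAt_of_isOpen φ.open_source hy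
  have h : ∀ᶠ z in 𝓝 y, W z = ∑ j, ((fun y => mvfderiv (𝓡 d) (fun y => φ y j) y (W y)) •
      chartField φ j) z := by
    filter_upwards [φ.open_source.mem_nhds hy] with z hz
    exact (sum_mvfderiv_coord_smul_chartField hφ hz (W z)).symm
  rw [divergence_congr (hW.mdiffAt_of_isOpen φ.open_source hy)
    (.sum_section fun j _ => (hw j).smul_section (hX j)) h,
    divergence_sum fun j _ => (hw j).smul_section (hX j), Finset.mul_sum]
  refine Finset.sum_congr rfl fun j _ => ?_
  rw [divergence_smul (hw j) (hX j), mvfderiv_mul hρ (hw j)]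
  simp only [add_apply, smul_apply, smul_eq_mul, mvfderiv_chartDensity hφ hy]
  ring

theorem continuousOn_divergence (hφ : φ ∈ IsManifold.maximalAtlas (𝓡 d) ∞ M)
    (hW : IsSmoothFieldOn W φ.source) : ContinuousOn (divergence W) φ.source := by
  have h : ContMDiffOn (𝓡 d) 𝓘(ℝ, ℝ) ∞ (fun y => ∑ j, mvfderiv (𝓡 d)
      (chartDensity φ * fun y => mvfderiv (𝓡 d) (fun y => φ y j) y (W y)) y (chartField φ j y))
      φ.source :=
    contMDiffOn_finsetSum fun j _ => contMDiffOn_mvfderiv_apply φ.open_source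
      ((contMDiffOn_chartDensity hφ).mul (contMDiffOn_coord_field hφ hW j))
      (contMDiffOn_chartField hφ j)
  refine (h.continuousOn.div (contMDiffOn_chartDensity hφ).continuousOn
    fun y hy => (chartDensity_pos hφ hy).ne').congr fun y hy => ?_
  rw [Pi.div_apply, ← chartDensity_mul_divergence hφ hW hy,
    mul_div_cancel_left₀ _ (chartDensity_pos hφ hy).ne']

/-! ### The divergence theorem -/

/-- The integral over the target of a chart of a coordinate derivative of a function with compact
support in the domain of the chart vanishes. -/
theorem setIntegral_mvfderiv_chartField [T2Space M]
    (hφ : φ ∈ IsManifold.maximalAtlas (𝓡 d) ∞ M) {K : Set M} (hK : IsCompact K)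
    (hKφ : K ⊆ φ.source) {f : M → ℝ} (hf : ContMDiffOn (𝓡 d) 𝓘(ℝ, ℝ) ∞ f φ.source)
    (hfK : ∀ y ∉ K, f y = 0) (j : Fin d) :
    IntegrableOn (fun u => mvfderiv (𝓡 d) f (φ.symm u) (chartField φ j (φ.symm u))) φ.target ∧
      ∫ u in φ.target, mvfderiv (𝓡 d) f (φ.symm u) (chartField φ j (φ.symm u)) = 0 := by
  set h : EuclideanSpace ℝ (Fin d) → ℝ := φ.target.indicator (f ∘ φ.symm) with hh
  set L := φ '' K with hL
  have hLc : IsCompact L := hK.image_of_continuousOn (φ.continuousOn.mono hKφ)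
  have hLt : L ⊆ φ.target := by
    rintro _ ⟨y, hy, rfl⟩
    exact φ.map_source (hKφ hy)
  have h0 : ∀ u ∉ L, h u = 0 := by
    intro u hu
    by_cases hut : u ∈ φ.target
    · rw [hh, Set.indicator_of_mem hut]
      exact hfK _ fun hK' => hu ⟨_, hK', φ.right_inv hut⟩
    · exact Set.indicator_of_notMem hut _
  have hnear : ∀ u ∈ φ.target, h =ᶠ[𝓝 u] f ∘ φ.symm := by
    intro u hu
    filter_upwards [φ.open_target.mem_nhds hu] with w hw
    exact Set.indicator_of_mem hw _
  have hsmooth : ContDiff ℝ ∞ h := by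
    rw [contDiff_iff_contDiffAt]
    intro u
    by_cases hu : u ∈ φ.target
    · refine (((contDiffOn_comp_symm hφ hf).contDiffAt
        ((φ.symm.isOpen_inter_preimage φ.open_source).mem_nhds
          ⟨hu, φ.map_target hu⟩))).congr_of_eventuallyEq (hnear u hu)
    · refine (contDiffAt_const (c := (0 : ℝ))).congr_of_eventuallyEq ?_
      filter_upwards [hLc.isClosed.isOpen_compl.mem_nhds fun h' => hu (hLt h')] with w hw
      exact h0 w hw
  have hcs : HasCompactSupport h := HasCompactSupport.intro hLc h0
  set v : EuclideanSpace ℝ (Fin d) := EuclideanSpace.single j 1 with hv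
  have hint : Integrable (fun u => fderiv ℝ h u v) := by
    refine Continuous.integrable_of_hasCompactSupport ?_ (hcs.fderiv_apply ℝ v)
    exact (hsmooth.continuous_fderiv (by simp)).clm_apply continuous_const
  have heq : ∀ u ∈ φ.target, fderiv ℝ h u v =
      mvfderiv (𝓡 d) f (φ.symm u) (chartField φ j (φ.symm u)) := by
    intro u hu
    rw [(hnear u hu).fderiv_eq, fderiv_comp_symm hφ hu
      (hf.mdiffAt_of_isOpen φ.open_source (φ.map_target hu))]
    simp [hv]
  refine ⟨hint.integrableOn.congr_fun heq φ.open_target.measurableSet, ?_⟩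
  rw [← setIntegral_congr_fun φ.open_target.measurableSet heq,
    setIntegral_eq_integral_of_forall_compl_eq_zero]
  -- Integration by parts against the constant function `1`.
  · have hparts := integral_mul_fderiv_eq_neg_fderiv_mul_of_integrable (μ := volume)
      (f := fun _ : EuclideanSpace ℝ (Fin d) => (1 : ℝ)) (g := h) (v := v)
      (by simp) (by simpa using hint)
      (by simpa using hsmooth.continuous.integrable_of_hasCompactSupport hcs)
      (fun _ _ => differentiableAt_const _)
      (fun _ _ => (hsmooth.differentiable (by simp)).differentiableAt)
    simpa using hparts
  · intro u hu
    have : h =ᶠ[𝓝 u] fun _ => 0 := by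
      filter_upwards [hLc.isClosed.isOpen_compl.mem_nhds fun h' => hu (hLt h')] with w hw
      exact h0 w hw
    rw [this.fderiv_eq]
    simp

variable [MeasurableSpace M] [BorelSpace M]

/-- The divergence theorem for a field with support in the domain of a chart. -/
theorem integral_divergence_of_subset_source [T2Space M]
    (hφ : φ ∈ atlas (EuclideanSpace ℝ (Fin d)) M) {K : Set M} (hK : IsCompact K)
    (hKφ : K ⊆ φ.source) (hW : IsSmoothFieldOn W Set.univ) (hWK : ∀ y ∉ K, W y = 0) :
    ∫ y, divergence W y ∂(riemannianVolume d M) = 0 := by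
  have hφ' := IsManifold.subset_maximalAtlas (I := 𝓡 d) (n := ∞) hφ
  have hWφ : IsSmoothFieldOn W φ.source := hW.mono (Set.subset_univ _)
  have hoff : ∀ y ∉ φ.source, divergence W y = 0 := by
    intro y hy
    rw [divergence_congr (Y := fun y => 0) (hW.mdiffAt_of_isOpen isOpen_univ (Set.mem_univ y))
      (mdifferentiable_zeroSection ℝ _ y) ?_, divergence_zero]
    filter_upwards [hK.isClosed.isOpen_compl.mem_nhds fun h => hy (hKφ h)] with z hz
    exact hWK z hz
  rw [← setIntegral_eq_integral_of_forall_compl_eq_zero hoff,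
    setIntegral_source_riemannianVolume hφ (continuousOn_divergence hφ' hWφ),
    setIntegral_congr_fun φ.open_target.measurableSet fun u hu =>
      chartDensity_mul_divergence hφ' hWφ (φ.map_target hu)]
  have h := fun j => setIntegral_mvfderiv_chartField hφ' hK hKφ
    ((contMDiffOn_chartDensity hφ').mul (contMDiffOn_coord_field hφ' hWφ j))
    (fun y hy => by simp [hWK y hy]) j
  rw [integral_finsetSum _ fun j _ => (h j).1]
  exact Finset.sum_eq_zero fun j _ => (h j).2

/-- The divergence theorem on a closed Riemannian manifold. -/
theorem integral_divergence [T2Space M] [CompactSpace M] (hW : IsSmoothFieldOn W Set.univ) :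
    Integrable (divergence W) (riemannianVolume d M) ∧
      ∫ y, divergence W y ∂(riemannianVolume d M) = 0 := by
  have := isLocallyFiniteMeasure_riemannianVolume (d := d) (M := M)
  have hint : ∀ W : ∀ x : M, TangentSpace (𝓡 d) x, IsSmoothFieldOn W Set.univ →
      Integrable (divergence W) (riemannianVolume d M) := by
    intro W hW
    have hc : Continuous (divergence W) := by
      refine continuous_iff_continuousAt.2 fun x => ?_
      have hφ := IsManifold.subset_maximalAtlas (I := 𝓡 d) (n := ∞)
        (chart_mem_atlas (EuclideanSpace ℝ (Fin d)) x)
      exact (continuousOn_divergence hφ (hW.mono (Set.subset_univ _))).continuousAt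
        ((chartAt _ x).open_source.mem_nhds (mem_chart_source _ x))
    exact hc.integrable_of_hasCompactSupport (.of_compactSpace _)
  refine ⟨hint W hW, ?_⟩
  obtain ⟨ρ, hρ⟩ := SmoothPartitionOfUnity.exists_isSubordinate_chartAt_source (𝓡 d) M
  have hfin := ρ.locallyFinite.finite_nonempty_of_compact
  set s := hfin.toFinset with hs
  have hsum : ∀ y, ∑ i ∈ s, ρ i y = 1 := by
    intro y
    rw [← ρ.sum_eq_one (Set.mem_univ y), finsum_eq_sum_of_support_subset]
    intro i hi
    simp only [hs, Set.Finite.coe_toFinset, Set.mem_ofPred_eq]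
    exact ⟨y, hi⟩
  have hρW : ∀ i, IsSmoothFieldOn (fun y => ρ i y • W y) Set.univ := fun i =>
    ((ρ i).contMDiff.contMDiffOn).smul_section hW
  have hW' : W = fun y => ∑ i ∈ s, ρ i y • W y := by
    ext1 y
    rw [← Finset.sum_smul, hsum, one_smul]
  have hdiv : ∀ y, divergence W y = ∑ i ∈ s, divergence (fun y => ρ i y • W y) y := by
    intro y
    conv_lhs => rw [hW']
    exact divergence_sum fun i _ => (hρW i).mdiffAt_of_isOpen isOpen_univ (Set.mem_univ y)
  simp only [hdiv]
  rw [integral_finsetSum _ fun i _ => hint _ (hρW i)]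
  refine Finset.sum_eq_zero fun i _ => ?_
  refine integral_divergence_of_subset_source (chart_mem_atlas _ i)
    (isClosed_tsupport (ρ i)).isCompact (hρ i) (hρW i) fun y hy => ?_
  rw [image_eq_zero_of_notMem_tsupport hy, zero_smul]

end Chart

end

theorem theorem6 {n p : ℕ} {M : Type*} [TopologicalSpace M] [T2Space M] [CompactSpace M]
    [ChartedSpace (EuclideanSpace ℝ (Fin (n + p))) M] [IsManifold (𝓡 (n + p)) ∞ M]
    [RiemannianBundle (fun x : M => TangentSpace (𝓡 (n + p)) x)]
    [IsContMDiffRiemannianBundle (𝓡 (n + p)) ∞ (EuclideanSpace ℝ (Fin (n + p)))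
      (fun x : M => TangentSpace (𝓡 (n + p)) x)]
    [MeasurableSpace M] [BorelSpace M]
    (F : Foliation (n + p) n M) (F' : Foliation (n + p) p M)
    (horth : ∀ x : M, F.tangent x ⟂ F'.tangent x) :
    Integrable
        (fun x : M => mixedScalarCurvature F.tangent F'.tangent x
          + normSqSecondFundamentalForm F.tangent x + normSqSecondFundamentalForm F'.tangent x
          - ‖meanCurvatureVector F.tangent x‖ ^ 2 - ‖meanCurvatureVector F'.tangent x‖ ^ 2)
        (riemannianVolume (n + p) M) ∧
      ∫ x : M, (mixedScalarCurvature F.tangent F'.tangent x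
          + normSqSecondFundamentalForm F.tangent x + normSqSecondFundamentalForm F'.tangent x
          - ‖meanCurvatureVector F.tangent x‖ ^ 2 - ‖meanCurvatureVector F'.tangent x‖ ^ 2)
        ∂(riemannianVolume (n + p) M) = 0 := by
  set Z : ∀ x : M, TangentSpace (𝓡 (n + p)) x :=
    fun x => meanCurvatureVector F.tangent x + meanCurvatureVector F'.tangent x with hZ
  have hZs : IsSmoothFieldOn Z Set.univ := by
    intro x _
    obtain ⟨U, hU, hx, e, he⟩ := exists_isAdaptedFrameOn F F' horth x
    exact ((he.contMDiffOn_meanCurvatureVector_add hU).contMDiffAt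
      (hU.mem_nhds hx)).contMDiffWithinAt
  have hdiv : ∀ x, mixedScalarCurvature F.tangent F'.tangent x
      + normSqSecondFundamentalForm F.tangent x + normSqSecondFundamentalForm F'.tangent x
      - ‖meanCurvatureVector F.tangent x‖ ^ 2 - ‖meanCurvatureVector F'.tangent x‖ ^ 2 =
      divergence Z x := by
    intro x
    obtain ⟨U, hU, hx, e, he⟩ := exists_isAdaptedFrameOn F F' horth x
    exact (he.divergence_meanCurvatureVector_add hU hx).symm
  simp only [hdiv]
  exact integral_divergence hZs
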